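/- **Model.** Let $M\ge 0$ and $1\le K\le N$ be integers, $\mu\in[0,1]$, $r\ge 0$. $M$ edge nodes (ENs) serve $K$ users from a library of $N$ files $F_1,\dots,F_N$, i.i.d. uniform on a set of $2^L$ elements. The channel is $\mathbf H=(h_{km})\in\mathbb C^{K\times M}$ with i.i.d. entries from a continuous (atomless) probability distribution on $\mathbb C$; it is constant during a transmission interval and known to all nodes. All logarithms are to base $2$ and entropies $H(\cdot)$ are in bits. A policy for file size $L$, power $P$ and fronthaul capacity $C_F$ consists of: (a) caching functions $S_{m,n}=\pi_{c,n}^m(F_n)$ with $H(S_{m,n})\le\mu L$, which depend neither on other files nor on the demand or the channel; put $S_m=(S_{m,1},\dots,S_{m,N})$; (b) for each demand vector $\mathbf D=(d_1,\dots,d_K)\in\{1,\dots,N\}^K$ and channel $\mathbf H$, durations $T_F,T_E\in\mathbb Z_{\ge0}$ and fronthaul messages $\mathbf U_m=\pi_f^m(F_1,\dots,F_N,S_m,\mathbf D,\mathbf H)$ of $T_F$ symbols with $H(\mathbf U_m)\le T_FC_F$; (c) codewords $\mathbf X_m=\pi_e^m(S_m,\mathbf U_m,\mathbf D,\mathbf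 H)\in\mathbb C^{T_E}$ of average power at most $P$, i.e. $\mathbb E\sum_{t=1}^{T_E}|X_m[t]|^2\le T_EP$; (d) measurable decoders $\widehat F_{d_k}=\pi_d^k(\mathbf Y_k,d_k,\mathbf H)$, where $Y_k[t]=\sum_m h_{km}X_m[t]+n_k[t]$ and the noise $n_k[t]\sim\mathcal{CN}(0,1)$ is i.i.d. over users and time and independent of the files. The error probability is $P_e(\mathbf H)=\max_{\mathbf D}\max_k\mathbb P(\widehat F_{d_k}\ne F_{d_k})$. A sequence of policies indexed by $L$ is feasible if, for almost every $\mathbf H$, $P_e(\mathbf H)\to0$ as $L\to\infty$; its delivery time per bit is $\Delta=\limsup_{L\to\infty}\max_{\mathbf D}(T_F+T_E)/L$. A value $\delta\in[0,\infty]$ is an achievable normalized delivery time (NDT) for $(\mu,r)$ if there are sequences of policies, one for each $P$, with $C_F=r\log_2P$, feasible for all sufficiently large $P$, whose delivery times per bit $\Delta_P$ satisfy $\lim_{P\to\infty}\Delta_P\log_2P=\delta$ for almost every $\mathbf H$. The minimum NDT $\delta^*(\mu,r)$ is the infimum of the achievable NDTs ($+\infty$ if there is none). **Proposition.** One has $\delta^*(\mu,r)\ge\delta_{LB}(\mu,r)$,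 where $\delta_{LB}(\mu,r)$ is the minimum value ($+\infty$ if infeasible) of the linear program in the real variables $\delta_F,\delta_E$ $$\text{minimize }\ \delta_F+\delta_E\quad\text{subject to}\quad \ell\,\delta_E+(M-\ell)\,r\,\delta_F\ \ge\ K-(M-\ell)(K-\ell)\mu\quad\text{for all integers } 0\le\ell\le\min\{M,K\},$$ $$\delta_F\ge0,\qquad \delta_E\ge1 .$$ -/

import Mathlib

open Filter Topology MeasureTheory ProbabilityTheory
open scoped ENNReal NNReal

namespace FRAN

/-- A file of `L` bits. -/
abbrev File (L : ℕ) : Type := Fin (2 ^ L)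

/-- A realization of the library of `N` files of `L` bits each. -/
abbrev Library (N L : ℕ) : Type := Fin N → File L

/-- A demand vector: user `k` requests the file with index `D k`. -/
abbrev Demand (K N : ℕ) : Type := Fin K → Fin N

/-- A channel realization: `H k m` is the coefficient from edge node `m` to user `k`. -/
abbrev Channel (K M : ℕ) : Type := Fin K → Fin M → ℂ

open Classical in
/-- The Shannon entropy, in bits, of `g X` where `X` is uniform on the finite set `α`. -/
noncomputable def entropyBits {α β : Type} [Fintype α] (g : α → β) : ℝ :=
  (∑ b ∈ Finset.univ.image g,
    Real.negMulLog
      (((Finset.univ.filter fun a => g a = b).card : ℝ) / (Fintype.card α : ℝ))) / Real.log 2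

/-- The circularly symmetric complex Gaussian law `CN(0,1)`: independent real and imaginary
parts, each Gaussian with mean `0` and variance `1/2`. -/
noncomputable def stdComplexGaussian : Measure ℂ :=
  ((gaussianReal 0 (1 / 2)).prod (gaussianReal 0 (1 / 2))).map
    Complex.measurableEquivRealProd.symm

/-- The law of the channel: the coefficients are i.i.d. with law `ν`. -/
noncomputable def channelLaw (K M : ℕ) (ν : Measure ℂ) : Measure (Channel K M) :=
  Measure.pi fun _ : Fin K => Measure.pi fun _ : Fin M => ν

/-- The law of the noise at `K` users over `T` channel uses: i.i.d. `CN(0,1)`. -/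
noncomputable def noiseLaw (K T : ℕ) : Measure (Fin K → Fin T → ℂ) :=
  Measure.pi fun _ : Fin K => Measure.pi fun _ : Fin T => stdComplexGaussian

/-- The joint law of the files (i.i.d. uniform, i.e. uniform on the library realizations) and of
the noise, which are independent. -/
noncomputable def sourceNoiseLaw (N L K T : ℕ) :
    Measure (Library N L × (Fin K → Fin T → ℂ)) :=
  (uniformOn (Set.univ : Set (Library N L))).prod (noiseLaw K T)

/-- A caching, fronthaul, edge transmission and decoding policy for `M` edge nodes, `K` users and
`N` files of `L` bits, with fractional cache size `μ`, fronthaul capacity `CF` (bits per symbol)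
and power `P`. Cached contents and fronthaul symbols are functions on a finite set, so taking
them in `ℕ` loses no generality. -/
structure Policy (M K N : ℕ) (μ CF P : ℝ) (L : ℕ) where
  /-- `cache m n F` is what edge node `m` stores of file `n` when that file is `F`. It depends
  neither on the other files nor on the demand or the channel. -/
  cache : Fin M → Fin N → File L → ℕ
  cache_le : ∀ m n, entropyBits (cache m n) ≤ μ * L
  /-- The fronthaul duration. -/
  TF : Demand K N → Channel K M → ℕ
  /-- The edge transmission duration. -/
  TE : Demand K N → Channel K M → ℕ
  /-- The fronthaul message to edge node `m`, a function of the demand, the channel, the whole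
  library and the cached content of `m`. -/
  fronthaul : ∀ (_ : Fin M) (D : Demand K N) (H : Channel K M),
    Library N L → (Fin N → ℕ) → (Fin (TF D H) → ℕ)
  /-- The fronthaul message has at most `TF * CF` bits. -/
  fronthaul_le : ∀ m D H,
    entropyBits (fun F : Library N L => fronthaul m D H F (fun n => cache m n (F n)))
      ≤ (TF D H : ℝ) * CF
  /-- The codeword sent by edge node `m`, a function of the demand, the channel, the cached
  content of `m` and the fronthaul message received by `m`. -/
  edge : ∀ (_ : Fin M) (D : Demand K N) (H : Channel K M),
    (Fin N → ℕ) → (Fin (TF D H) → ℕ) → (Fin (TE D H) → ℂ)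
  /-- Average power constraint: the power averaged over the block and the files is at most `P`. -/
  power_le : ∀ m D H,
    (∑ F : Library N L, ∑ t : Fin (TE D H),
      ‖edge m D H (fun n => cache m n (F n))
        (fronthaul m D H F (fun n => cache m n (F n))) t‖ ^ 2) / (Fintype.card (Library N L) : ℝ)
      ≤ (TE D H : ℝ) * P
  /-- The estimate of user `k`, who knows the index of the requested file and the channel and
  receives a block of some length `T`. -/
  decode : Fin K → Fin N → Channel K M → (T : ℕ) → (Fin T → ℂ) → File L
  measurable_decode : ∀ k d H T, Measurable (decode k d H T)

namespace Policy

variable {M K N : ℕ} {μ CF P : ℝ} {L : ℕ}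

/-- The content of the cache of edge node `m`. -/
def cached (π : Policy M K N μ CF P L) (m : Fin M) (F : Library N L) : Fin N → ℕ :=
  fun n => π.cache m n (F n)

/-- The fronthaul message received by edge node `m`. -/
def message (π : Policy M K N μ CF P L) (D : Demand K N) (H : Channel K M) (m : Fin M)
    (F : Library N L) : Fin (π.TF D H) → ℕ :=
  π.fronthaul m D H F (π.cached m F)

/-- The codeword sent by edge node `m`. -/
def input (π : Policy M K N μ CF P L) (D : Demand K N) (H : Channel K M) (m : Fin M)
    (F : Library N L) : Fin (π.TE D H) → ℂ :=
  π.edge m D H (π.cached m F) (π.message D H m F)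

/-- The signal received by user `k` when the files are `F` and the noise is `z`. -/
noncomputable def output (π : Policy M K N μ CF P L) (D : Demand K N) (H : Channel K M)
    (k : Fin K) (F : Library N L) (z : Fin K → Fin (π.TE D H) → ℂ) : Fin (π.TE D H) → ℂ :=
  fun t => ∑ m, H k m * π.input D H m F t + z k t

/-- The probability of error for the channel realization `H`: the worst case over the demands and
the users of the probability that a user does not recover the requested file. -/
noncomputable def errorProb (π : Policy M K N μ CF P L) (H : Channel K M) : ℝ≥0∞ :=
  ⨆ D : Demand K N, ⨆ k : Fin K,
    sourceNoiseLaw N L K (π.TE D H)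
      {ω | π.decode k (D k) H (π.TE D H) (π.output D H k ω.1 ω.2) ≠ ω.1 (D k)}

/-- The worst-case delivery time over the demands, for the channel realization `H`. -/
noncomputable def deliveryTime (π : Policy M K N μ CF P L) (H : Channel K M) : ℝ≥0∞ :=
  ⨆ D : Demand K N, ((π.TF D H : ℝ≥0∞) + (π.TE D H : ℝ≥0∞))

end Policy

/-- A sequence of policies indexed by the file size `L` is feasible if, for almost all channel
realizations, the probability of error vanishes as `L → ∞`. -/
def Feasible {M K N : ℕ} {μ CF P : ℝ} (ν : Measure ℂ)
    (π : (L : ℕ) → Policy M K N μ CF P L) : Prop :=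
  ∀ᵐ H ∂(channelLaw K M ν), Tendsto (fun L => (π L).errorProb H) atTop (𝓝 0)

/-- The delivery time per bit of a sequence of policies, for the channel realization `H`. -/
noncomputable def deliveryTimePerBit {M K N : ℕ} {μ CF P : ℝ}
    (π : (L : ℕ) → Policy M K N μ CF P L) (H : Channel K M) : ℝ≥0∞ :=
  limsup (fun L : ℕ => (π L).deliveryTime H / (L : ℝ≥0∞)) atTop

/-- `δ` is an achievable normalized delivery time (NDT): with fronthaul capacity `r log₂ P`, there
are feasible sequences of policies, one for each `P`, whose delivery time per bit, divided by
`1 / log₂ P`, tends to `δ` as `P → ∞`, for almost all channel realizations. -/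
def AchievableNDT (M K N : ℕ) (ν : Measure ℂ) (μ r : ℝ) (δ : ℝ≥0∞) : Prop :=
  ∃ π : (P : ℝ) → (L : ℕ) → Policy M K N μ (r * Real.logb 2 P) P L,
    (∀ᶠ P in atTop, Feasible ν (π P)) ∧
    ∀ᵐ H ∂(channelLaw K M ν),
      Tendsto (fun P : ℝ => deliveryTimePerBit (π P) H * ENNReal.ofReal (Real.logb 2 P))
        atTop (𝓝 δ)

/-- The minimum NDT; it is `∞` if no NDT is achievable. -/
noncomputable def minNDT (M K N : ℕ) (ν : Measure ℂ) (μ r : ℝ) : ℝ≥0∞ :=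
  sInf {δ | AchievableNDT M K N ν μ r δ}

/-- The constraints of the linear program. -/
def LPFeasible (M K : ℕ) (μ r δF δE : ℝ) : Prop :=
  (∀ l : ℕ, l ≤ min M K →
    (K : ℝ) - ((M : ℝ) - l) * ((K : ℝ) - l) * μ ≤ l * δE + ((M : ℝ) - l) * r * δF) ∧
  0 ≤ δF ∧ 1 ≤ δE

/-- The value of the linear program "minimize `δF + δE`"; it is `∞` if the program is infeasible.
On feasible points the objective is at least `1`, so `ENNReal.ofReal` truncates nothing. -/
noncomputable def lpValue (M K : ℕ) (μ r : ℝ) : ℝ≥0∞ :=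
  sInf {v | ∃ δF δE : ℝ, LPFeasible M K μ r δF δE ∧ v = ENNReal.ofReal (δF + δE)}

end FRAN

/-! Fix ℓ ≤ min(M, K), a demand for K distinct files (possible as K ≤ N) and a channel whose leading
ℓ×ℓ minor is nonzero, which is almost sure. On the first ℓ columns every channel row is then a
combination of the first ℓ rows. A receiver that observes the first ℓ users with reduced noise, and
knows the codewords of the other M − ℓ edge nodes, can subtract these codewords, recombine, restore
them and add noise up to unit variance. It thus simulates the output of any user and can run all K
decoders.

Those M − ℓ codewords are functions of fronthaul messages, costing (M − ℓ) T_F C_F bits, and of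
caches. Only the cached parts of the K − ℓ files requested by the remaining users are paid for, at
μL bits each per edge node: the first ℓ files are decoded from the observations alone, and the
unrequested files may be given for free. The ℓ observed signals carry at most ℓ T_E (log P + O(1))
bits. Hence, up to terms from the decoding errors, KL ≤ ℓ T_E (log P + O(1)) + (M − ℓ)(K − ℓ) μL +
(M − ℓ) T_F C_F, which is `Policy.converse`. One observed user and no side information give δ_E ≥ 1.

Mutual information and Fano's inequality are replaced by likelihoods. `sum_guess_le` is the chain
rule: side information together with guesses defines a subprobability on libraries.
`lintegral_blockRatio_mul` changes the law of the observations to one independent of the files.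
`sum_integral_le_zero_of_le_logb` then bounds the expected log-likelihood.

Dividing by L, normalizing by log P and extracting a convergent subsequence
(`exists_LPFeasible_of_approx`) turns an achievable NDT into a feasible point of the linear program
with no larger objective. -/

namespace FRAN

/-! ### Kraft-type inequalities: side information and successive guessing. -/

section Kraft

variable {α β : Type*}

open Classical in
/-- `W` is the pullback along `τ` of a nonnegative weight whose sum over the range of `τ` is at
most `1`. -/
def IsKraft [Fintype α] (τ : α → β) (W : α → ℝ) : Prop :=
  ∃ p : β → ℝ, (∀ b, 0 ≤ p b) ∧ (∀ a, W a = p (τ a)) ∧ ∑ b ∈ Finset.univ.image τ, p b ≤ 1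

lemma IsKraft.comp {γ : Type*} [Fintype α] [Fintype γ] {τ : α → β} {W : α → ℝ}
    (h : IsKraft τ W) (f : γ → α) :
    IsKraft (fun c => τ (f c)) (fun c => W (f c)) := by
  classical
  obtain ⟨p, hp, hW, hs⟩ := h
  refine ⟨p, hp, fun c => hW _, le_trans (Finset.sum_le_sum_of_subset_of_nonneg ?_ ?_) hs⟩
  · intro b hb
    simp only [Finset.mem_image, Finset.mem_univ, true_and] at hb ⊢
    obtain ⟨c, rfl⟩ := hb
    exact ⟨_, rfl⟩
  · intro b _ _; exact hp b

lemma IsKraft.prodMk {β' : Type*} [Fintype α] {τ : α → β} {W : α → ℝ} {τ' : α → β'} {W' : α → ℝ}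
    (h : IsKraft τ W) (h' : IsKraft τ' W') :
    IsKraft (fun a => (τ a, τ' a)) (fun a => W a * W' a) := by
  classical
  obtain ⟨p, hp, hW, hs⟩ := h
  obtain ⟨p', hp', hW', hs'⟩ := h'
  refine ⟨fun b => p b.1 * p' b.2, fun b => mul_nonneg (hp _) (hp' _),
    fun a => by simp [hW, hW'], ?_⟩
  refine le_trans (le_of_eq ?_) (calc
    ∑ b ∈ Finset.univ.image fun a => (τ a, τ' a), p b.1 * p' b.2
    _ ≤ ∑ b ∈ Finset.univ.image τ ×ˢ Finset.univ.image τ', p b.1 * p' b.2 := by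
        refine Finset.sum_le_sum_of_subset_of_nonneg ?_ fun b _ _ => mul_nonneg (hp _) (hp' _)
        intro b hb
        simp only [Finset.mem_image, Finset.mem_univ, true_and, Finset.mem_product] at hb ⊢
        obtain ⟨a, rfl⟩ := hb
        exact ⟨⟨a, rfl⟩, ⟨a, rfl⟩⟩
    _ = (∑ b ∈ Finset.univ.image τ, p b) * ∑ b ∈ Finset.univ.image τ', p' b := by
        rw [Finset.sum_product, Finset.sum_mul_sum]
    _ ≤ 1 := mul_le_one₀ hs (Finset.sum_nonneg fun b _ => hp' b) hs')
  congr!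

lemma IsKraft.pi {ι : Type*} [Fintype ι] {δ : ι → Type*} [Fintype α] {τ : ∀ i, α → δ i}
    {W : ι → α → ℝ} (h : ∀ i, IsKraft (τ i) (W i)) :
    IsKraft (fun a i => τ i a) (fun a => ∏ i, W i a) := by
  classical
  choose p hp hW hs using h
  refine ⟨fun b => ∏ i, p i (b i), fun b => Finset.prod_nonneg fun i _ => hp i _,
    fun a => by simp [hW], ?_⟩
  refine le_trans (le_of_eq ?_) (calc
    ∑ b ∈ Finset.univ.image fun a i => τ i a, ∏ i, p i (b i)
    _ ≤ ∑ b ∈ Fintype.piFinset fun i => Finset.univ.image (τ i), ∏ i, p i (b i) := by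
        refine Finset.sum_le_sum_of_subset_of_nonneg ?_
          fun b _ _ => Finset.prod_nonneg fun i _ => hp i _
        intro b hb
        simp only [Finset.mem_image, Finset.mem_univ, true_and, Fintype.mem_piFinset] at hb ⊢
        obtain ⟨a, rfl⟩ := hb
        exact fun i => ⟨a, rfl⟩
    _ = ∏ i, ∑ b ∈ Finset.univ.image (τ i), p i b := by
        rw [Finset.prod_univ_sum]
    _ ≤ 1 := Finset.prod_le_one (fun i _ => Finset.sum_nonneg fun b _ => hp i b)
        fun i _ => hs i)
  congr!

/-- The sum over the values of coordinates in `B` of guesses which are predictable from the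
coordinates outside `B`, followed by the sum over the remaining coordinates. -/
lemma sum_predictable_guess_le {ι : Type*} [Fintype ι] [Fintype α] [DecidableEq ι]
    (B : Finset ι) (q : ι → α → α → ℝ) (hq0 : ∀ n c x, 0 ≤ q n c x)
    (hq : ∀ n c, ∑ x, q n c x ≤ 1) (c₀ : ι → α) (v : (ι → α) → ι → α)
    (hv₀ : ∀ F n, n ∉ B → v F n = c₀ n)
    (hv : ∀ F F', (∀ n, n ∉ B → F n = F' n) → v F = v F') :
    ∑ F : ι → α, ∏ n, q n (v F n) (F n) ≤ 1 := by
  classical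
  let e := Equiv.piEquivPiSubtypeProd (fun n => n ∈ B) (fun _ : ι => α)
  rw [← e.symm.sum_comp, Fintype.sum_prod_type_right]
  have hsplit : ∀ (Z : {n // n ∈ B} → α) (R : {n // n ∉ B} → α),
      ∏ n, q n (v (e.symm (Z, R)) n) (e.symm (Z, R) n)
        = (∏ n : {n // n ∈ B}, q n (v (e.symm (fun _ => c₀ n, R)) n) (Z n)) *
          ∏ n : {n // n ∉ B}, q n (c₀ n) (R n) := by
    intro Z R
    rw [← Fintype.prod_subtype_mul_prod_subtype (fun n => n ∈ B)]
    congr 1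
    · refine Finset.prod_congr (by ext; simp) fun n _ => ?_
      -- The guess ignores the coordinates in `B`, so these can be frozen at an arbitrary filler;
      -- each factor then depends on `Z` only through `Z n`, and the sum over `Z` factorizes.
      rw [hv (e.symm (Z, R)) (e.symm (fun _ => c₀ n, R))]
      · congr 1
        simp [e, n.2]
      · intro i hi
        simp [e, hi]
    · refine Finset.prod_congr rfl fun n _ => ?_
      rw [hv₀ _ _ n.2]
      congr 1
      simp [e, n.2]
  simp_rw [hsplit, ← Finset.sum_mul]
  have hZ : ∀ R : {n // n ∉ B} → α,
      ∑ Z : {n // n ∈ B} → α,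
        ∏ n : {n // n ∈ B}, q n (v (e.symm (fun _ => c₀ n, R)) n) (Z n) ≤ 1 := by
    intro R
    rw [← Fintype.prod_sum (fun (n : {n // n ∈ B}) (x : α) =>
      q n (v (e.symm (fun _ => c₀ n, R)) n) x)]
    exact Finset.prod_le_one (fun n _ => Finset.sum_nonneg fun x _ => hq0 _ _ _)
      fun n _ => hq _ _
  calc _ ≤ ∑ R : {n // n ∉ B} → α, 1 * ∏ n : {n // n ∉ B}, q n (c₀ n) (R n) :=
        Finset.sum_le_sum fun R _ => mul_le_mul_of_nonneg_right (hZ R)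
          (Finset.prod_nonneg fun n _ => hq0 _ _ _)
    _ = ∏ n : {n // n ∉ B}, ∑ x, q n (c₀ n) x := by
        simp only [one_mul]
        rw [← Fintype.prod_sum (fun (n : {n // n ∉ B}) (x : α) => q n (c₀ n) x)]
    _ ≤ 1 := Finset.prod_le_one (fun n _ => Finset.sum_nonneg fun x _ => hq0 _ _ _)
        fun n _ => hq _ _

/-- A family of guesses of the coordinates, where those in `B` may use the other coordinates and
a side information `τ F`, has total likelihood at most `1` once `τ F` is paid for. -/
lemma sum_guess_le {ι : Type*} [Fintype ι] [Fintype α] [DecidableEq ι]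
    {τ : (ι → α) → β} {W : (ι → α) → ℝ} (hW : IsKraft τ W)
    (B : Finset ι) (q : ι → α → α → ℝ) (hq0 : ∀ n c x, 0 ≤ q n c x)
    (hq : ∀ n c, ∑ x, q n c x ≤ 1) (c₀ : ι → α) (v : (ι → α) → ι → α)
    (hv₀ : ∀ F n, n ∉ B → v F n = c₀ n)
    (hv : ∀ F F', τ F = τ F' → (∀ n, n ∉ B → F n = F' n) → ∀ n ∈ B, v F n = v F' n) :
    ∑ F : ι → α, W F * ∏ n, q n (v F n) (F n) ≤ 1 := by
  classical
  obtain ⟨p, hp, hWp, hs⟩ := hW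
  have hfib : ∀ b, ∑ F : ι → α with τ F = b, ∏ n, q n (v F n) (F n) ≤ 1 := by
    intro b
    let P : (ι → α) → (ι → α) → Prop := fun F F' => τ F' = b ∧ ∀ n, n ∉ B → F n = F' n
    let R : (ι → α) → (ι → α) := fun F n => if n ∈ B then c₀ n else F n
    -- `v'` uses the guess of some point of the fiber of `b` that agrees with `F` off `B`. As `R`
    -- erases the coordinates in `B`, `v'` depends on the others only, even outside the fiber; on
    -- the fiber it equals `v`.
    let v' : (ι → α) → ι → α := fun F n =>
      if h : n ∈ B ∧ ∃ F', P (R F) F' then v h.2.choose n else c₀ n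
    have hv' : ∀ F, τ F = b → v' F = v F := by
      intro F hF
      have hex : ∃ F', P (R F) F' := ⟨F, hF, fun n hn => by simp [R, hn]⟩
      funext n
      by_cases hn : n ∈ B
      · simp only [v', hn, hex, true_and, dif_pos]
        have hc := hex.choose_spec
        refine hv _ _ (hc.1.trans hF.symm) (fun i hi => ?_) n hn
        rw [← hc.2 i hi]
        simp [R, hi]
      · simp [v', hn, hv₀ F n hn]
    calc ∑ F : ι → α with τ F = b, ∏ n, q n (v F n) (F n)
        = ∑ F : ι → α with τ F = b, ∏ n, q n (v' F n) (F n) :=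
          Finset.sum_congr rfl fun F hF => by
            rw [hv' F (by simpa using hF)]
      _ ≤ ∑ F : ι → α, ∏ n, q n (v' F n) (F n) :=
          Finset.sum_le_sum_of_subset_of_nonneg (Finset.filter_subset _ _)
            fun F _ _ => Finset.prod_nonneg fun n _ => hq0 _ _ _
      _ ≤ 1 := by
          refine sum_predictable_guess_le B q hq0 hq c₀ v' (fun F n hn => by simp [v', hn]) ?_
          intro F F' h
          have : R F = R F' := by
            funext n
            by_cases hn : n ∈ B
            · simp [R, hn]
            · simp [R, hn, h n hn]
          simp only [v', this]
  calc ∑ F : ι → α, W F * ∏ n, q n (v F n) (F n)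
      = ∑ b ∈ Finset.univ.image τ, ∑ F : ι → α with τ F = b,
          W F * ∏ n, q n (v F n) (F n) :=
        (Finset.sum_fiberwise_of_maps_to (fun F _ => Finset.mem_image_of_mem _ (Finset.mem_univ F))
          _).symm
    _ = ∑ b ∈ Finset.univ.image τ, p b * ∑ F : ι → α with τ F = b,
          ∏ n, q n (v F n) (F n) := by
        refine Finset.sum_congr rfl fun b _ => ?_
        rw [Finset.mul_sum]
        refine Finset.sum_congr rfl fun F hF => ?_
        rw [hWp, (Finset.mem_filter.1 hF).2]
    _ ≤ ∑ b ∈ Finset.univ.image τ, p b * 1 :=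
        Finset.sum_le_sum fun b _ => mul_le_mul_of_nonneg_left (hfib b) (hp b)
    _ ≤ 1 := by simpa using hs

end Kraft

/-! ### Entropy as an averaged log-probability. -/

section Entropy

open Classical in
/-- The probability of the value `g a` of `g`, under the uniform law. -/
noncomputable def fiberProb {α β : Type} [Fintype α] (g : α → β) (a : α) : ℝ :=
  ((Finset.univ.filter fun a' => g a' = g a).card : ℝ) / (Fintype.card α : ℝ)

variable {α β : Type} [Fintype α]

lemma fiberProb_pos (g : α → β) (a : α) : 0 < fiberProb g a := by
  classical
  unfold fiberProb
  have h1 : 0 < (Finset.univ.filter fun a' => g a' = g a).card :=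
    Finset.card_pos.2 ⟨a, by simp⟩
  have h2 : 0 < Fintype.card α := Fintype.card_pos_iff.2 ⟨a⟩
  positivity

lemma isKraft_fiberProb (g : α → β) : IsKraft g (fiberProb g) := by
  classical
  refine ⟨fun b => ((Finset.univ.filter fun a' => g a' = b).card : ℝ) / (Fintype.card α : ℝ),
    fun b => by positivity, fun a => rfl, ?_⟩
  rw [← Finset.sum_div, ← Nat.cast_sum, ← Finset.card_eq_sum_card_image, Finset.card_univ]
  exact div_self_le_one _

/-- Grouping the points by their value of `g` turns the sum into the entropy sum. With
`isKraft_fiberProb`, this makes `fiberProb g` a weight whose mean cost in bits is exactly the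
entropy. -/
lemma sum_logb_fiberProb (g : α → β) :
    (∑ a, Real.logb 2 (fiberProb g a)) = -(Fintype.card α * entropyBits g) := by
  classical
  have h := Finset.sum_comp (s := (Finset.univ : Finset α))
    (fun b => Real.logb 2
      (((Finset.univ.filter fun a' => g a' = b).card : ℝ) / (Fintype.card α : ℝ))) g
  unfold fiberProb
  simp only at h ⊢
  rw [h]
  unfold entropyBits
  rw [← mul_div_assoc, ← neg_div, Finset.mul_sum, ← Finset.sum_neg_distrib, Finset.sum_div]
  refine Finset.sum_congr (by congr) fun b hb => ?_
  obtain ⟨a, -, -⟩ := Finset.mem_image.1 hb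
  have h2 : (Fintype.card α : ℝ) ≠ 0 := by
    have : 0 < Fintype.card α := Fintype.card_pos_iff.2 ⟨a⟩
    positivity
  rw [Real.negMulLog, Real.logb, nsmul_eq_mul]
  field_simp

end Entropy

/-! ### Densities and changes of measure on finite products. -/

section PiMeasure

variable {ι : Type*} [Fintype ι] {X : ι → Type*} [∀ i, MeasurableSpace (X i)]

lemma lintegral_pi_prod (μ : ∀ i, Measure (X i)) [∀ i, IsProbabilityMeasure (μ i)]
    (f : ∀ i, X i → ℝ≥0∞) (hf : ∀ i, Measurable (f i)) :
    ∫⁻ x, ∏ i, f i (x i) ∂(Measure.pi μ) = ∏ i, ∫⁻ y, f i y ∂(μ i) := by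
  rw [lintegral_prod_eq_prod_lintegral_of_indepFun Finset.univ (fun i (x : ∀ i, X i) => f i (x i))
    (iIndepFun_pi fun i => (hf i).aemeasurable) (fun i => (hf i).comp (measurable_pi_apply i))]
  refine Finset.prod_congr rfl fun i _ => ?_
  rw [← (measurePreserving_eval μ i).lintegral_comp (hf i)]

lemma pi_withDensity (μ : ∀ i, Measure (X i)) [∀ i, IsProbabilityMeasure (μ i)]
    (f : ∀ i, X i → ℝ≥0∞) (hf : ∀ i, Measurable (f i))
    [∀ i, SigmaFinite ((μ i).withDensity (f i))] :
    Measure.pi (fun i => (μ i).withDensity (f i))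
      = (Measure.pi μ).withDensity fun x => ∏ i, f i (x i) := by
  refine (Measure.pi_eq fun s hs => ?_)
  rw [withDensity_apply _ (MeasurableSet.univ_pi hs),
    ← lintegral_indicator (MeasurableSet.univ_pi hs)]
  have : ∀ x : ∀ i, X i, (Set.univ.pi s).indicator (fun x => ∏ i, f i (x i)) x
      = ∏ i, (s i).indicator (f i) (x i) := by
    intro x
    by_cases hx : x ∈ Set.univ.pi s
    · rw [Set.indicator_of_mem hx]
      exact Finset.prod_congr rfl fun i _ => (Set.indicator_of_mem (hx i trivial) _).symm
    · rw [Set.indicator_of_notMem hx]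
      obtain ⟨i, hi⟩ : ∃ i, x i ∉ s i := by simpa [Set.mem_pi] using hx
      exact (Finset.prod_eq_zero (Finset.mem_univ i) (Set.indicator_of_notMem hi _)).symm
  simp_rw [this]
  rw [lintegral_pi_prod μ _ fun i => (hf i).indicator (hs i)]
  refine Finset.prod_congr rfl fun i _ => ?_
  rw [withDensity_apply _ (hs i), lintegral_indicator (hs i)]

/-- A coordinatewise change of measure. -/
lemma pi_withDensity_map {Y : ι → Type*} [∀ i, MeasurableSpace (Y i)]
    (μ : ∀ i, Measure (X i)) [∀ i, IsProbabilityMeasure (μ i)]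
    (f : ∀ i, X i → ℝ≥0∞) (hf : ∀ i, Measurable (f i))
    (φ ψ : ∀ i, X i → Y i) (hφ : ∀ i, Measurable (φ i)) (hψ : ∀ i, Measurable (ψ i))
    (h : ∀ i, ((μ i).withDensity (f i)).map (φ i) = (μ i).map (ψ i)) :
    ((Measure.pi μ).withDensity fun x => ∏ i, f i (x i)).map (fun x i => φ i (x i))
      = (Measure.pi μ).map (fun x i => ψ i (x i)) := by
  have hprob : ∀ i, IsProbabilityMeasure ((μ i).withDensity (f i)) := by
    intro i
    have h1 := congrArg (fun m => m Set.univ) (h i)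
    simp only [Measure.map_apply (hφ i) MeasurableSet.univ,
      Measure.map_apply (hψ i) MeasurableSet.univ, Set.preimage_univ, measure_univ] at h1
    exact ⟨h1⟩
  have h1 : ∀ i, SigmaFinite (((μ i).withDensity (f i)).map (φ i)) := fun i =>
    have := Measure.isProbabilityMeasure_map (μ := (μ i).withDensity (f i)) (hφ i).aemeasurable
    inferInstance
  have h2 : ∀ i, SigmaFinite ((μ i).map (ψ i)) := fun i => by
    rw [← h i]; exact h1 i
  rw [← pi_withDensity μ f hf, Measure.pi_map_pi fun i => (hφ i).aemeasurable,
    Measure.pi_map_pi fun i => (hψ i).aemeasurable]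
  simp_rw [h]

end PiMeasure

/-! ### The complex Gaussian law: linear combinations, second moment, likelihood ratio. -/

section Gaussian

instance : IsProbabilityMeasure stdComplexGaussian := by
  unfold stdComplexGaussian
  exact Measure.isProbabilityMeasure_map Complex.measurableEquivRealProd.symm.measurable.aemeasurable

instance (K T : ℕ) : IsProbabilityMeasure (noiseLaw K T) := by
  unfold noiseLaw; infer_instance

lemma integral_stdComplexGaussian (g : ℂ → ℂ) :
    ∫ z, g z ∂stdComplexGaussian
      = ∫ p : ℝ × ℝ, g ⟨p.1, p.2⟩ ∂((gaussianReal 0 (1 / 2)).prod (gaussianReal 0 (1 / 2))) := by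
  unfold stdComplexGaussian
  rw [MeasureTheory.integral_map_equiv]
  rfl

lemma charFun_stdComplexGaussian (t : ℂ) :
    charFun stdComplexGaussian t = Complex.exp (-(‖t‖ ^ 2 / 4 : ℝ)) := by
  rw [charFun_apply, integral_stdComplexGaussian]
  have h1 : ∀ p : ℝ × ℝ, Complex.exp (inner ℝ (⟨p.1, p.2⟩ : ℂ) t * Complex.I)
      = Complex.exp (t.re * p.1 * Complex.I) * Complex.exp (t.im * p.2 * Complex.I) := by
    intro p
    rw [← Complex.exp_add, Complex.inner]
    congr 1
    simp
    ring
  simp_rw [h1]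
  rw [integral_prod_mul (fun x : ℝ => Complex.exp (t.re * x * Complex.I))
    (fun x : ℝ => Complex.exp (t.im * x * Complex.I)), ← charFun_apply_real, ← charFun_apply_real,
    charFun_gaussianReal, charFun_gaussianReal, ← Complex.exp_add]
  congr 1
  rw [← Complex.normSq_eq_norm_sq, Complex.normSq_apply]
  push_cast
  simp
  ring

/-- A linear combination of independent `CN(0,1)` variables is `CN(0,1)` when the squared norms of
the coefficients sum to one. -/
lemma map_sum_mul_stdComplexGaussian {ι : Type*} [Fintype ι] (a : ι → ℂ)
    (ha : ∑ i, ‖a i‖ ^ 2 = 1) :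
    (Measure.pi fun _ : ι => stdComplexGaussian).map (fun z => ∑ i, a i * z i)
      = stdComplexGaussian := by
  have hm : Measurable fun z : ι → ℂ => ∑ i, a i * z i := by fun_prop
  have := Measure.isProbabilityMeasure_map (μ := Measure.pi fun _ : ι => stdComplexGaussian)
    hm.aemeasurable
  refine Measure.ext_of_charFun (funext fun t => ?_)
  rw [charFun_apply, integral_map hm.aemeasurable (by fun_prop)]
  have h1 : ∀ z : ι → ℂ, Complex.exp (inner ℝ (∑ i, a i * z i) t * Complex.I)
      = ∏ i, Complex.exp (inner ℝ (z i) (starRingEnd ℂ (a i) * t) * Complex.I) := by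
    intro z
    rw [← Complex.exp_sum, sum_inner, Complex.ofReal_sum, Finset.sum_mul]
    congr 1
    refine Finset.sum_congr rfl fun i _ => ?_
    congr 2
    simp only [Complex.inner, map_mul]
    congr 1
    ring
  simp_rw [h1]
  rw [integral_fintype_prod_eq_prod (μ := fun _ : ι => stdComplexGaussian)
    (fun i (x : ℂ) => Complex.exp (inner ℝ x (starRingEnd ℂ (a i) * t) * Complex.I))]
  simp_rw [← charFun_apply, charFun_stdComplexGaussian]
  rw [← Complex.exp_sum]
  congr 1
  simp only [norm_mul, RCLike.norm_conj, mul_pow]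
  rw [Finset.sum_neg_distrib, ← Complex.ofReal_sum, ← Finset.sum_div, ← Finset.sum_mul, ha, one_mul]

lemma norm_sq_measurableEquivRealProd_symm (p : ℝ × ℝ) :
    ‖Complex.measurableEquivRealProd.symm p‖ ^ 2 = p.1 ^ 2 + p.2 ^ 2 := by
  rw [← Complex.normSq_eq_norm_sq, Complex.normSq_apply, sq, sq]
  simp

lemma integrable_norm_sq_stdComplexGaussian :
    Integrable (fun z : ℂ => ‖z‖ ^ 2) stdComplexGaussian := by
  unfold stdComplexGaussian
  rw [integrable_map_equiv]
  have h1 : Integrable (fun x : ℝ => x ^ 2) (gaussianReal 0 (1 / 2)) :=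
    (memLp_id_gaussianReal 2).integrable_sq
  have h2 := (h1.comp_fst (gaussianReal 0 (1 / 2))).add (h1.comp_snd (gaussianReal 0 (1 / 2)))
  exact h2.congr (ae_of_all _ fun p => (norm_sq_measurableEquivRealProd_symm p).symm)

lemma integral_norm_sq_stdComplexGaussian :
    ∫ z, ‖z‖ ^ 2 ∂stdComplexGaussian = 1 := by
  unfold stdComplexGaussian
  rw [MeasureTheory.integral_map_equiv]
  have h1 : Integrable (fun x : ℝ => x ^ 2) (gaussianReal 0 (1 / 2)) :=
    (memLp_id_gaussianReal 2).integrable_sq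
  have h2 : ∫ x, x ^ 2 ∂(gaussianReal 0 (1 / 2)) = 1 / 2 := by
    have := variance_fun_id_gaussianReal (μ := 0) (v := 1 / 2)
    rw [variance_eq_integral (by fun_prop)] at this
    simpa [integral_id_gaussianReal] using this
  simp_rw [norm_sq_measurableEquivRealProd_symm]
  rw [integral_add (h1.comp_fst _) (h1.comp_snd _),
    integral_fun_fst (fun x : ℝ => x ^ 2), integral_fun_snd (fun x : ℝ => x ^ 2), h2]
  simp
  norm_num

/-- The likelihood ratio of `CN(0, β)` with respect to `CN(a, σ²)`, at `a + σ z`. -/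
noncomputable def gaussRatio (σ β : ℝ) (a z : ℂ) : ℝ :=
  σ ^ 2 / β * Real.exp (‖z‖ ^ 2 - ‖a + σ * z‖ ^ 2 / β)

lemma gaussRatio_pos {σ β : ℝ} (hσ : 0 < σ) (hβ : 0 < β) (a z : ℂ) : 0 < gaussRatio σ β a z := by
  unfold gaussRatio; positivity

lemma measurable_gaussRatio (σ β : ℝ) (a : ℂ) : Measurable (gaussRatio σ β a) := by
  unfold gaussRatio; fun_prop

lemma stdComplexGaussian_eq_withDensity :
    stdComplexGaussian
      = (volume : Measure ℂ).withDensity fun z => ENNReal.ofReal (Real.pi⁻¹ * Real.exp (-‖z‖ ^ 2)) := by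
  have hv : (1 / 2 : ℝ≥0) ≠ 0 := by norm_num
  have hm : Measurable fun z : ℂ => ENNReal.ofReal (Real.pi⁻¹ * Real.exp (-‖z‖ ^ 2)) := by fun_prop
  unfold stdComplexGaussian
  rw [gaussianReal_of_var_ne_zero _ hv,
    prod_withDensity (measurable_gaussianPDF _ _) (measurable_gaussianPDF _ _)]
  refine Measure.ext fun s hs => ?_
  rw [Measure.map_apply Complex.measurableEquivRealProd.symm.measurable hs,
    withDensity_apply _ (Complex.measurableEquivRealProd.symm.measurable hs),
    withDensity_apply _ hs,
    ← (Complex.volume_preserving_equiv_real_prod.symm _).setLIntegral_comp_preimage hs hm]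
  refine lintegral_congr fun p => ?_
  rw [gaussianPDF, gaussianPDF, ← ENNReal.ofReal_mul (gaussianPDFReal_nonneg _ _ _)]
  congr 1
  rw [gaussianPDFReal, gaussianPDFReal, mul_mul_mul_comm, ← Real.exp_add, ← mul_inv,
    Real.mul_self_sqrt (by positivity)]
  rw [norm_sq_measurableEquivRealProd_symm]
  congr 2
  · push_cast; ring
  · push_cast; ring

lemma lintegral_comp_add_mul {c : ℝ} (hc : 0 < c) (a : ℂ) {f : ℂ → ℝ≥0∞} (hf : Measurable f) :
    ∫⁻ z, f (a + c * z) = ENNReal.ofReal (c ^ 2)⁻¹ * ∫⁻ z, f z := by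
  have h1 := Measure.map_addHaar_smul (volume : Measure ℂ) hc.ne'
  rw [Complex.finrank_real_complex, abs_of_pos (by positivity)] at h1
  have hf' : Measurable fun z => f (a + z) := by fun_prop
  calc ∫⁻ z, f (a + c * z) = ∫⁻ z, f (a + z) ∂((volume : Measure ℂ).map (c • ·)) := by
        rw [lintegral_map hf' (by fun_prop)]
        simp only [Complex.real_smul]
    _ = ENNReal.ofReal (c ^ 2)⁻¹ * ∫⁻ z, f (a + z) := by
        rw [h1, lintegral_smul_measure, smul_eq_mul]
    _ = _ := by rw [lintegral_add_left_eq_self f a]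

/-- Reweighting turns the law CN(a, σ²) of `a + σ z` into CN(0, β), which no longer involves `a`.
Both sides are compared as integrals against Lebesgue measure after an affine substitution. -/
lemma gaussRatio_map {σ β : ℝ} (hσ : 0 < σ) (hβ : 0 < β) (a : ℂ) :
    (stdComplexGaussian.withDensity fun z => ENNReal.ofReal (gaussRatio σ β a z)).map
        (fun z => a + σ * z)
      = stdComplexGaussian.map (fun z => (Real.sqrt β : ℂ) * z) := by
  have hg : Measurable fun z : ℂ => ENNReal.ofReal (Real.pi⁻¹ * Real.exp (-‖z‖ ^ 2)) := by fun_prop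
  have hρ : Measurable fun z : ℂ => ENNReal.ofReal (gaussRatio σ β a z) :=
    (measurable_gaussRatio σ β a).ennreal_ofReal
  have hsβ : 0 < Real.sqrt β := Real.sqrt_pos.2 hβ
  refine Measure.ext_of_lintegral _ fun f hf => ?_
  -- The test function times the CN(0, β) density, up to the factor 1/β; both integrands are affine
  -- pullbacks of it.
  let k : ℂ → ℝ≥0∞ := fun y => ENNReal.ofReal (Real.pi⁻¹ * Real.exp (-(‖y‖ ^ 2 / β))) * f y
  have hk : Measurable k := by fun_prop
  have hL : ∀ z : ℂ, ENNReal.ofReal (Real.pi⁻¹ * Real.exp (-‖z‖ ^ 2)) *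
      (ENNReal.ofReal (gaussRatio σ β a z) * f (a + σ * z))
        = ENNReal.ofReal (σ ^ 2 / β) * k (a + σ * z) := by
    intro z
    simp only [k]
    rw [← mul_assoc, ← mul_assoc, ← ENNReal.ofReal_mul (by positivity),
      ← ENNReal.ofReal_mul (by positivity), gaussRatio]
    congr 2
    have : Real.exp (-(‖a + σ * z‖ ^ 2 / β))
        = Real.exp (-‖z‖ ^ 2) * Real.exp (‖z‖ ^ 2 - ‖a + σ * z‖ ^ 2 / β) := by
      rw [← Real.exp_add]; congr 1; ring
    rw [this]; ring
  have hR : ∀ z : ℂ, ENNReal.ofReal (Real.pi⁻¹ * Real.exp (-‖z‖ ^ 2)) *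
      f ((Real.sqrt β : ℂ) * z) = k (0 + (Real.sqrt β : ℝ) * z) := by
    intro z
    simp only [k, zero_add]
    congr 4
    rw [norm_mul, Complex.norm_real, Real.norm_of_nonneg hsβ.le, mul_pow, Real.sq_sqrt hβ.le]
    field_simp
  rw [lintegral_map hf (by fun_prop), lintegral_map hf (by fun_prop),
    lintegral_withDensity_eq_lintegral_mul _ hρ (by fun_prop), stdComplexGaussian_eq_withDensity,
    lintegral_withDensity_eq_lintegral_mul _ hg (by fun_prop),
    lintegral_withDensity_eq_lintegral_mul _ hg (by fun_prop)]
  simp only [Pi.mul_apply]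
  simp_rw [hL, hR]
  rw [lintegral_const_mul _ (by fun_prop), lintegral_comp_add_mul hσ a hk,
    lintegral_comp_add_mul hsβ 0 hk, ← mul_assoc, ← ENNReal.ofReal_mul (by positivity),
    Real.sq_sqrt hβ.le]
  congr 2
  field_simp

end Gaussian

/-! ### Blocks of Gaussian observations and their change of measure. -/

section GaussianBlock

variable {T ι : Type*}

open Classical in
/-- The coordinates in `S` are scaled by `σ` and shifted by `a`. -/
noncomputable def shifted (S : Finset ι) (σ : ℝ) (a z : T → ι → ℂ) : T → ι → ℂ :=
  fun t i => if i ∈ S then a t i + σ * z t i else z t i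

open Classical in
/-- The coordinates in `S` are rescaled to have variance `β`. -/
noncomputable def rescaled (S : Finset ι) (β : ℝ) (z : T → ι → ℂ) : T → ι → ℂ :=
  fun t i => if i ∈ S then (Real.sqrt β : ℂ) * z t i else z t i

lemma measurable_shifted (S : Finset ι) (σ : ℝ) (a : T → ι → ℂ) : Measurable (shifted S σ a) := by
  refine measurable_pi_lambda _ fun t => measurable_pi_lambda _ fun i => ?_
  by_cases hi : i ∈ S
  · simp only [shifted, hi, if_true]; fun_prop
  · simp only [shifted, hi, if_false]; fun_prop

lemma measurable_rescaled (S : Finset ι) (β : ℝ) :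
    Measurable (rescaled S β : (T → ι → ℂ) → T → ι → ℂ) := by
  refine measurable_pi_lambda _ fun t => measurable_pi_lambda _ fun i => ?_
  by_cases hi : i ∈ S
  · simp only [rescaled, hi, if_true]; fun_prop
  · simp only [rescaled, hi, if_false]; fun_prop

/-- The likelihood ratio of the law of `rescaled` with respect to that of `shifted`. -/
noncomputable def blockRatio [Fintype T] (S : Finset ι) (σ β : ℝ) (a z : T → ι → ℂ) : ℝ :=
  ∏ t, ∏ i ∈ S, gaussRatio σ β (a t i) (z t i)

lemma blockRatio_pos [Fintype T] {σ β : ℝ} (hσ : 0 < σ) (hβ : 0 < β) (S : Finset ι) (a z : T → ι → ℂ) :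
    0 < blockRatio S σ β a z :=
  Finset.prod_pos fun _ _ => Finset.prod_pos fun _ _ => gaussRatio_pos hσ hβ _ _

lemma measurable_blockRatio [Fintype T] (S : Finset ι) (σ β : ℝ) (a : T → ι → ℂ) :
    Measurable (blockRatio S σ β a) := by
  unfold blockRatio
  refine Finset.measurable_prod _ fun t _ => Finset.measurable_prod _ fun i _ => ?_
  exact (measurable_gaussRatio σ β (a t i)).comp (by fun_prop)

/-- A pointwise lower bound on `Real.logb 2` of `gaussRatio`. -/
lemma le_logb_gaussRatio {σ β : ℝ} (hσ : 0 < σ) (hβ : 0 < β) (a z : ℂ) :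
    Real.logb 2 (σ ^ 2 / β) + (‖z‖ ^ 2 - (2 * ‖a‖ ^ 2 + 2 * σ ^ 2 * ‖z‖ ^ 2) / β) / Real.log 2
      ≤ Real.logb 2 (gaussRatio σ β a z) := by
  have h2 : 0 < Real.log 2 := Real.log_pos (by norm_num)
  -- The crude factor 2 removes the cross term, so only second moments have to be integrated; it
  -- costs a constant in `β`, which is invisible at the scale of log P.
  have h : ‖a + σ * z‖ ^ 2 ≤ 2 * ‖a‖ ^ 2 + 2 * σ ^ 2 * ‖z‖ ^ 2 := by
    have h1 : ‖a + σ * z‖ ≤ ‖a‖ + σ * ‖z‖ := by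
      refine (norm_add_le _ _).trans_eq ?_
      rw [norm_mul, Complex.norm_real, Real.norm_of_nonneg hσ.le]
    have h3 := pow_le_pow_left₀ (norm_nonneg _) h1 2
    nlinarith [sq_nonneg (‖a‖ - σ * ‖z‖)]
  rw [gaussRatio, Real.logb_mul (by positivity) (Real.exp_pos _).ne']
  gcongr
  rw [Real.logb, Real.log_exp]
  gcongr

/-- A lower bound on `Real.logb 2` of `blockRatio`, with an explicit integral. -/
noncomputable def logRatioBound [Fintype T] (S : Finset ι) (σ β : ℝ) (a z : T → ι → ℂ) : ℝ :=
  ∑ t, ∑ i ∈ S, (Real.logb 2 (σ ^ 2 / β) +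
    (‖z t i‖ ^ 2 - (2 * ‖a t i‖ ^ 2 + 2 * σ ^ 2 * ‖z t i‖ ^ 2) / β) / Real.log 2)

lemma logRatioBound_le [Fintype T] {σ β : ℝ} (hσ : 0 < σ) (hβ : 0 < β) (S : Finset ι) (a z : T → ι → ℂ) :
    logRatioBound S σ β a z ≤ Real.logb 2 (blockRatio S σ β a z) := by
  rw [blockRatio, Real.logb_prod _ _ fun t _ =>
    Finset.prod_ne_zero_iff.2 fun i _ => (gaussRatio_pos hσ hβ _ _).ne']
  refine Finset.sum_le_sum fun t _ => ?_
  rw [Real.logb_prod _ _ fun i _ => (gaussRatio_pos hσ hβ _ _).ne']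
  exact Finset.sum_le_sum fun i _ => le_logb_gaussRatio hσ hβ _ _

/-- Independent `CN(0,1)` variables indexed by `T × ι`. -/
noncomputable def gaussianBlock (T ι : Type*) [Fintype T] [Fintype ι] : Measure (T → ι → ℂ) :=
  Measure.pi fun _ : T => Measure.pi fun _ : ι => stdComplexGaussian

variable [Fintype T] [Fintype ι]

instance : IsProbabilityMeasure (gaussianBlock T ι) := by
  unfold gaussianBlock; infer_instance

/-- `gaussRatio_map` applied coordinatewise, with ratio 1 off `S`. The right side does not involve
`a`: after the change of measure the observations have the same law for all libraries, so a sum over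
libraries can be taken under the integral. -/
lemma lintegral_blockRatio_mul {σ β : ℝ} (hσ : 0 < σ) (hβ : 0 < β) (S : Finset ι)
    (a : T → ι → ℂ) {G : (T → ι → ℂ) → ℝ≥0∞} (hG : Measurable G) :
    ∫⁻ z, ENNReal.ofReal (blockRatio S σ β a z) * G (shifted S σ a z) ∂(gaussianBlock T ι)
      = ∫⁻ z, G (rescaled S β z) ∂(gaussianBlock T ι) := by
  classical
  let f : T → ι → ℂ → ℝ≥0∞ := fun t i z =>
    if i ∈ S then ENNReal.ofReal (gaussRatio σ β (a t i) z) else 1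
  let φ : T → ι → ℂ → ℂ := fun t i z => if i ∈ S then a t i + σ * z else z
  let ψ : T → ι → ℂ → ℂ := fun _ i z => if i ∈ S then (Real.sqrt β : ℂ) * z else z
  have hf : ∀ t i, Measurable (f t i) := fun t i => by
    by_cases hi : i ∈ S
    · simp only [f, hi, if_true]; exact (measurable_gaussRatio σ β (a t i)).ennreal_ofReal
    · simp only [f, hi, if_false]; fun_prop
  have hφ : ∀ t i, Measurable (φ t i) := fun t i => by
    by_cases hi : i ∈ S
    · simp only [φ, hi, if_true]; fun_prop
    · simp only [φ, hi, if_false]; fun_prop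
  have hψ : ∀ t i, Measurable (ψ t i) := fun t i => by
    by_cases hi : i ∈ S
    · simp only [ψ, hi, if_true]; fun_prop
    · simp only [ψ, hi, if_false]; fun_prop
  have h1 : ∀ t i, (stdComplexGaussian.withDensity (f t i)).map (φ t i)
      = stdComplexGaussian.map (ψ t i) := fun t i => by
    by_cases hi : i ∈ S
    · simp only [f, φ, ψ, hi, if_true]; exact gaussRatio_map hσ hβ (a t i)
    · simp only [f, φ, ψ, hi, if_false]
      congr 1
      exact withDensity_one
  have h2 : ∀ t, ((Measure.pi fun _ : ι => stdComplexGaussian).withDensity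
      fun x => ∏ i, f t i (x i)).map (fun x i => φ t i (x i))
        = (Measure.pi fun _ : ι => stdComplexGaussian).map (fun x i => ψ t i (x i)) := fun t =>
    pi_withDensity_map (fun _ : ι => stdComplexGaussian) (f t) (hf t) (φ t) (ψ t) (hφ t) (hψ t)
      (h1 t)
  have hφ' : ∀ t, Measurable fun (x : ι → ℂ) i => φ t i (x i) := fun t =>
    measurable_pi_lambda _ fun i => (hφ t i).comp (measurable_pi_apply i)
  have hψ' : ∀ t, Measurable fun (x : ι → ℂ) i => ψ t i (x i) := fun t =>
    measurable_pi_lambda _ fun i => (hψ t i).comp (measurable_pi_apply i)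
  have hf' : ∀ t, Measurable fun x : ι → ℂ => ∏ i, f t i (x i) := fun t =>
    Finset.measurable_prod _ fun i _ => (hf t i).comp (measurable_pi_apply i)
  have h3 := pi_withDensity_map (fun _ : T => Measure.pi fun _ : ι => stdComplexGaussian)
    (fun t x => ∏ i, f t i (x i)) hf' (fun t x i => φ t i (x i)) (fun t x i => ψ t i (x i))
    hφ' hψ' h2
  have hdens : ∀ z : T → ι → ℂ,
      ∏ t, ∏ i, f t i (z t i) = ENNReal.ofReal (blockRatio S σ β a z) := by
    intro z
    rw [blockRatio, ENNReal.ofReal_prod_of_nonneg fun t _ =>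
      Finset.prod_nonneg fun i _ => (gaussRatio_pos hσ hβ _ _).le]
    refine Finset.prod_congr rfl fun t _ => ?_
    rw [ENNReal.ofReal_prod_of_nonneg fun i _ => (gaussRatio_pos hσ hβ _ _).le]
    simp only [f, Finset.prod_ite_mem, Finset.univ_inter]
  simp_rw [hdens] at h3
  have h4 : ((gaussianBlock T ι).withDensity fun z =>
      ENNReal.ofReal (blockRatio S σ β a z)).map (shifted S σ a)
        = (gaussianBlock T ι).map (rescaled S β) := h3
  rw [← lintegral_map hG (measurable_rescaled S β), ← h4,
    lintegral_map hG (measurable_shifted S σ a)]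
  exact (lintegral_withDensity_eq_lintegral_mul _ (measurable_blockRatio S σ β a).ennreal_ofReal
    (hG.comp (measurable_shifted S σ a))).symm

lemma measurePreserving_eval_gaussianBlock (t : T) (i : ι) :
    MeasurePreserving (fun z : T → ι → ℂ => z t i) (gaussianBlock T ι) stdComplexGaussian :=
  (measurePreserving_eval (fun _ : ι => stdComplexGaussian) i).comp
    (measurePreserving_eval (fun _ : T => Measure.pi fun _ : ι => stdComplexGaussian) t)

lemma integrable_norm_sq_gaussianBlock (t : T) (i : ι) :
    Integrable (fun z : T → ι → ℂ => ‖z t i‖ ^ 2) (gaussianBlock T ι) :=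
  (measurePreserving_eval_gaussianBlock t i).integrable_comp_of_integrable
    integrable_norm_sq_stdComplexGaussian

lemma integral_norm_sq_gaussianBlock (t : T) (i : ι) :
    ∫ z : T → ι → ℂ, ‖z t i‖ ^ 2 ∂(gaussianBlock T ι) = 1 := by
  rw [← integral_norm_sq_stdComplexGaussian,
    ← (measurePreserving_eval_gaussianBlock (T := T) (ι := ι) t i).map_eq,
    integral_map (measurePreserving_eval_gaussianBlock t i).aemeasurable (by fun_prop)]

lemma integrable_logRatioBound (S : Finset ι) (σ β : ℝ) (a : T → ι → ℂ) :
    Integrable (logRatioBound S σ β a) (gaussianBlock T ι) := by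
  unfold logRatioBound
  refine integrable_finsetSum _ fun t _ => integrable_finsetSum _ fun i _ => ?_
  have h := integrable_norm_sq_gaussianBlock (T := T) (ι := ι) t i
  exact (integrable_const _).add ((h.sub
    (((integrable_const _).add (h.const_mul _)).div_const _)).div_const _)

lemma integral_logRatioBound (S : Finset ι) (σ β : ℝ) (a : T → ι → ℂ) :
    ∫ z, logRatioBound S σ β a z ∂(gaussianBlock T ι)
      = ∑ t, ∑ i ∈ S, (Real.logb 2 (σ ^ 2 / β) +
          (1 - (2 * ‖a t i‖ ^ 2 + 2 * σ ^ 2) / β) / Real.log 2) := by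
  unfold logRatioBound
  have h := fun t i => integrable_norm_sq_gaussianBlock (T := T) (ι := ι) t i
  have h1 : ∀ t i, Integrable (fun z : T → ι → ℂ =>
      (2 * ‖a t i‖ ^ 2 + 2 * σ ^ 2 * ‖z t i‖ ^ 2) / β) (gaussianBlock T ι) := fun t i =>
    ((integrable_const _).add ((h t i).const_mul _)).div_const _
  have h2 : ∀ t i, Integrable (fun z : T → ι → ℂ =>
      (‖z t i‖ ^ 2 - (2 * ‖a t i‖ ^ 2 + 2 * σ ^ 2 * ‖z t i‖ ^ 2) / β) / Real.log 2)
      (gaussianBlock T ι) := fun t i => ((h t i).sub (h1 t i)).div_const _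
  have h3 : ∀ t i, Integrable (fun z : T → ι → ℂ => Real.logb 2 (σ ^ 2 / β) +
      (‖z t i‖ ^ 2 - (2 * ‖a t i‖ ^ 2 + 2 * σ ^ 2 * ‖z t i‖ ^ 2) / β) / Real.log 2)
      (gaussianBlock T ι) := fun t i => (integrable_const _).add (h2 t i)
  rw [integral_finsetSum _ fun t _ => integrable_finsetSum _ fun i _ => h3 t i]
  refine Finset.sum_congr rfl fun t _ => ?_
  rw [integral_finsetSum _ fun i _ => h3 t i]
  refine Finset.sum_congr rfl fun i _ => ?_
  rw [integral_add (integrable_const _) (h2 t i), integral_div, integral_sub (h t i) (h1 t i),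
    integral_div, integral_add (integrable_const _) ((h t i).const_mul _),
    integral_const_mul (2 * σ ^ 2), integral_norm_sq_gaussianBlock]
  simp

/-- Linear combinations of the rows of a Gaussian block are i.i.d. `CN(0,1)`. -/
lemma gaussianBlock_map_sum (b : ι → ℂ) (hb : ∑ i, ‖b i‖ ^ 2 = 1) :
    (gaussianBlock T ι).map (fun z t => ∑ i, b i * z t i)
      = Measure.pi fun _ : T => stdComplexGaussian := by
  have h := map_sum_mul_stdComplexGaussian b hb
  have : ∀ _ : T, SigmaFinite ((Measure.pi fun _ : ι => stdComplexGaussian).map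
      (fun z => ∑ i, b i * z i)) := fun _ => by rw [h]; infer_instance
  unfold gaussianBlock
  rw [Measure.pi_map_pi (μ := fun _ : T => Measure.pi fun _ : ι => stdComplexGaussian)
    (f := fun _ z => ∑ i, b i * z i)
    (fun _ => (by fun_prop : Measurable fun z : ι → ℂ => ∑ i, b i * z i).aemeasurable)]
  simp_rw [h]

end GaussianBlock

/-- Gibbs' inequality: functions of total mass at most that of the constant `1` have nonpositive
expected logarithm. -/
lemma sum_integral_le_zero_of_le_logb {Ω α : Type*} [MeasurableSpace Ω] {Γ : Measure Ω}
    [IsProbabilityMeasure Γ] [Fintype α] {f g : α → Ω → ℝ} (hf0 : ∀ F z, 0 < f F z)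
    (hf : ∀ F, Measurable (f F))
    (hsum : ∑ F, ∫⁻ z, ENNReal.ofReal (f F z) ∂Γ ≤ Fintype.card α)
    (hg : ∀ F, Integrable (g F) Γ) (hgf : ∀ F z, g F z ≤ Real.logb 2 (f F z)) :
    ∑ F, ∫ z, g F z ∂Γ ≤ 0 := by
  have h2 : 0 < Real.log 2 := Real.log_pos (by norm_num)
  have hlt : ∀ F, ∫⁻ z, ENNReal.ofReal (f F z) ∂Γ < ∞ := fun F =>
    lt_of_le_of_lt ((Finset.single_le_sum (f := fun F => ∫⁻ z, ENNReal.ofReal (f F z) ∂Γ)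
      (fun _ _ => zero_le) (Finset.mem_univ F)).trans hsum) (ENNReal.natCast_lt_top _)
  have hfi : ∀ F, Integrable (f F) Γ := fun F =>
    ⟨(hf F).aestronglyMeasurable, by
      rw [hasFiniteIntegral_iff_ofReal (ae_of_all _ fun z => (hf0 F z).le)]; exact hlt F⟩
  have hint : ∑ F, ∫ z, f F z ∂Γ ≤ Fintype.card α := by
    have h : ∀ F, ∫ z, f F z ∂Γ = (∫⁻ z, ENNReal.ofReal (f F z) ∂Γ).toReal := fun F =>
      integral_eq_lintegral_of_nonneg_ae (ae_of_all _ fun z => (hf0 F z).le)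
        (hf F).aestronglyMeasurable
    simp_rw [h]
    rw [← ENNReal.toReal_sum fun F _ => (hlt F).ne]
    exact ENNReal.toReal_le_of_le_ofReal (by positivity) (by simpa using hsum)
  -- This is log x ≤ x − 1, integrated; only the minorant `g` has to be integrable, not the
  -- logarithm itself.
  have hle : ∀ F, ∫ z, g F z ∂Γ ≤ (∫ z, f F z ∂Γ - 1) / Real.log 2 := fun F => by
    have : (∫ z, f F z ∂Γ - 1) / Real.log 2 = ∫ z, (f F z - 1) / Real.log 2 ∂Γ := by
      rw [integral_div, integral_sub (hfi F) (integrable_const _)]; simp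
    rw [this]
    refine integral_mono (hg F) (((hfi F).sub (integrable_const _)).div_const _) fun z => ?_
    refine (hgf F z).trans ?_
    rw [Real.logb]
    exact div_le_div_of_nonneg_right (Real.log_le_sub_one_of_pos (hf0 F z)) h2.le
  calc ∑ F, ∫ z, g F z ∂Γ ≤ ∑ F, (∫ z, f F z ∂Γ - 1) / Real.log 2 :=
        Finset.sum_le_sum fun F _ => hle F
    _ = (∑ F, ∫ z, f F z ∂Γ - Fintype.card α) / Real.log 2 := by
        rw [← Finset.sum_div, Finset.sum_sub_distrib]; simp
    _ ≤ 0 := div_nonpos_of_nonpos_of_nonneg (by linarith) h2.le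

/-! ### Likelihoods of decoded files, in place of Fano's inequality. -/

section GuessWeight

/-- The likelihood assigned to the file `x` when the decoded file is `c`: half of the mass on `c`,
half of it uniform. -/
noncomputable def guessWeight (L : ℕ) (c x : File L) : ℝ :=
  if c = x then 1 / 2 else 1 / 2 * (1 / 2) ^ L

lemma guessWeight_pos (L : ℕ) (c x : File L) : 0 < guessWeight L c x := by
  unfold guessWeight; split_ifs <;> positivity

lemma sum_guessWeight_le (L : ℕ) (c : File L) : ∑ x, guessWeight L c x ≤ 1 := by
  have h : ∀ x, guessWeight L c x ≤ (if c = x then 1 / 2 else 0) + 1 / 2 * (1 / 2) ^ L := by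
    intro x
    unfold guessWeight
    split_ifs
    · have : (0 : ℝ) ≤ 1 / 2 * (1 / 2) ^ L := by positivity
      linarith
    · simp
  refine (Finset.sum_le_sum fun x _ => h x).trans ?_
  rw [Finset.sum_add_distrib, Finset.sum_ite_eq]
  have h2 : (2 : ℝ) ^ L * (1 / 2) ^ L = 1 := by rw [← mul_pow]; norm_num
  simp only [Finset.mem_univ, if_true, Finset.sum_const, Finset.card_univ, Fintype.card_fin,
    nsmul_eq_mul, Nat.cast_pow, Nat.cast_ofNat]
  linarith

/-- The Fano substitute: a correct guess costs 1 bit and a wrong one 1 + L bits, so the mean cost is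
1 + L times the error probability. -/
lemma logb_guessWeight (L : ℕ) (c x : File L) :
    Real.logb 2 (guessWeight L c x) = -(1 + L * if c = x then 0 else 1) := by
  have h : Real.logb 2 (1 / 2) = -1 := by
    rw [one_div, Real.logb_inv, Real.logb_self_eq_one (by norm_num)]
  unfold guessWeight
  split_ifs
  · rw [h]; ring
  · rw [Real.logb_mul (by norm_num) (by positivity), Real.logb_pow, h]; ring

/-- The likelihood of the file of index `n`, for guesses of the files with index in `S`. -/
noncomputable def indexWeight {N : ℕ} (L : ℕ) (S : Finset (Fin N)) (n : Fin N) (c x : File L) : ℝ :=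
  if n ∈ S then guessWeight L c x else (1 / 2) ^ L

variable {N : ℕ} (L : ℕ) (S : Finset (Fin N))

lemma indexWeight_pos (n : Fin N) (c x : File L) : 0 < indexWeight L S n c x := by
  unfold indexWeight; split_ifs
  · exact guessWeight_pos L c x
  · positivity

lemma sum_indexWeight_le (n : Fin N) (c : File L) : ∑ x, indexWeight L S n c x ≤ 1 := by
  unfold indexWeight
  split_ifs
  · exact sum_guessWeight_le L c
  · simp

lemma logb_prod_indexWeight (v F : Library N L) :
    Real.logb 2 (∏ n, indexWeight L S n (v n) (F n))
      = -(((N : ℝ) - S.card) * L) - ∑ n ∈ S, (1 + (L : ℝ) * if v n = F n then 0 else 1) := by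
  have h : Real.logb 2 (1 / 2) = -1 := by
    rw [one_div, Real.logb_inv, Real.logb_self_eq_one (by norm_num)]
  rw [Real.logb_prod _ _ fun n _ => (indexWeight_pos L S n _ _).ne',
    ← Finset.sum_add_sum_compl S]
  have h1 : ∑ n ∈ S, Real.logb 2 (indexWeight L S n (v n) (F n))
      = - ∑ n ∈ S, (1 + (L : ℝ) * if v n = F n then 0 else 1) := by
    rw [← Finset.sum_neg_distrib]
    refine Finset.sum_congr rfl fun n hn => ?_
    rw [indexWeight, if_pos hn, logb_guessWeight]
  have h2 : ∑ n ∈ Sᶜ, Real.logb 2 (indexWeight L S n (v n) (F n))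
      = -(((N : ℝ) - S.card) * L) := by
    have : ∀ n ∈ Sᶜ, Real.logb 2 (indexWeight L S n (v n) (F n)) = -L := fun n hn => by
      rw [indexWeight, if_neg (Finset.mem_compl.1 hn), Real.logb_pow, h]; ring
    rw [Finset.sum_congr rfl this, Finset.sum_const, Finset.card_compl, nsmul_eq_mul,
      Nat.cast_sub (Finset.card_le_univ S)]
    simp
  rw [h1, h2]; ring

end GuessWeight

/-! ### Error probability under an equivalent noise. -/

section ErrorProb

lemma uniformOn_univ_lintegral {α : Type*} [Fintype α] [MeasurableSpace α]
    [MeasurableSingletonClass α] (g : α → ℝ≥0∞) :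
    ∫⁻ a, g a ∂(uniformOn (Set.univ : Set α)) = (Fintype.card α : ℝ≥0∞)⁻¹ * ∑ a, g a := by
  rw [uniformOn, ProbabilityTheory.cond, lintegral_smul_measure, Measure.restrict_univ,
    lintegral_count, tsum_fintype, smul_eq_mul, Measure.count_univ]
  simp

variable {M K N : ℕ} {μ CF P : ℝ} {L : ℕ}

/-- The error probability of a user may be computed with any noise of law `CN(0,1)`. -/
lemma sum_measure_error_le (π : Policy M K N μ CF P L) (D : Demand K N) (H : Channel K M)
    (k : Fin K) {ι : Type*} [Fintype ι] (b : ι → ℂ) (hb : ∑ i, ‖b i‖ ^ 2 = 1) :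
    ∑ F : Library N L, (gaussianBlock (Fin (π.TE D H)) ι)
        {ζ | π.decode k (D k) H (π.TE D H)
          (fun t => ∑ m, H k m * π.input D H m F t + ∑ i, b i * ζ t i) ≠ F (D k)}
      ≤ Fintype.card (Library N L) * π.errorProb H := by
  set T := π.TE D H
  let s : Library N L → Set (Fin T → ℂ) := fun F =>
    {z | π.decode k (D k) H T (fun t => ∑ m, H k m * π.input D H m F t + z t) ≠ F (D k)}
  have hs : ∀ F, MeasurableSet (s F) := fun F => by
    have h : Measurable fun z : Fin T → ℂ =>
        π.decode k (D k) H T (fun t => ∑ m, H k m * π.input D H m F t + z t) :=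
      (π.measurable_decode k (D k) H T).comp (by fun_prop)
    exact (h (measurableSet_singleton (F (D k)))).compl
  have h1 : ∀ F, (gaussianBlock (Fin T) ι)
        {ζ | π.decode k (D k) H T
          (fun t => ∑ m, H k m * π.input D H m F t + ∑ i, b i * ζ t i) ≠ F (D k)}
      = (noiseLaw K T) ((fun z => z k) ⁻¹' s F) := fun F => by
    have hp := measurePreserving_eval
      (fun _ : Fin K => Measure.pi fun _ : Fin T => stdComplexGaussian) k
    rw [noiseLaw, show (fun z : Fin K → Fin T → ℂ => z k) = Function.eval k from rfl,
      hp.measure_preimage (hs F).nullMeasurableSet, ← gaussianBlock_map_sum b hb,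
      Measure.map_apply (by fun_prop) (hs F)]
    rfl
  have h2 : sourceNoiseLaw N L K T
      {ω | π.decode k (D k) H T (π.output D H k ω.1 ω.2) ≠ ω.1 (D k)}
        = (Fintype.card (Library N L) : ℝ≥0∞)⁻¹ *
          ∑ F, (noiseLaw K T) ((fun z => z k) ⁻¹' s F) := by
    have hm : MeasurableSet {ω : Library N L × (Fin K → Fin T → ℂ) |
        π.decode k (D k) H T (π.output D H k ω.1 ω.2) ≠ ω.1 (D k)} := by
      have : {ω : Library N L × (Fin K → Fin T → ℂ) |
          π.decode k (D k) H T (π.output D H k ω.1 ω.2) ≠ ω.1 (D k)}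
          = ⋃ F, {F} ×ˢ ((fun z : Fin K → Fin T → ℂ => z k) ⁻¹' s F) := by
        ext ω
        simp only [Set.mem_ofPred_eq, Set.mem_iUnion, Set.mem_prod, Set.mem_singleton_iff]
        constructor
        · intro h; exact ⟨ω.1, rfl, h⟩
        · rintro ⟨F, rfl, h⟩; exact h
      rw [this]
      exact MeasurableSet.iUnion fun F => (measurableSet_singleton F).prod
        ((measurable_pi_apply k) (hs F))
    rw [sourceNoiseLaw, Measure.prod_apply hm, uniformOn_univ_lintegral]
    rfl
  have hc : (Fintype.card (Library N L) : ℝ≥0∞) ≠ 0 := by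
    simp
  have h3 : (Fintype.card (Library N L) : ℝ≥0∞)⁻¹ *
      ∑ F, (noiseLaw K T) ((fun z => z k) ⁻¹' s F) ≤ π.errorProb H := by
    rw [← h2]
    exact le_iSup₂_of_le D k le_rfl
  calc _ = ∑ F, (noiseLaw K T) ((fun z => z k) ⁻¹' s F) := Finset.sum_congr rfl fun F _ => h1 F
    _ = Fintype.card (Library N L) * ((Fintype.card (Library N L) : ℝ≥0∞)⁻¹ *
          ∑ F, (noiseLaw K T) ((fun z => z k) ⁻¹' s F)) := by
        rw [← mul_assoc, ENNReal.mul_inv_cancel hc (ENNReal.natCast_ne_top _), one_mul]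
    _ ≤ _ := by gcongr

lemma errorProb_le_one (π : Policy M K N μ CF P L) (H : Channel K M) : π.errorProb H ≤ 1 := by
  have : IsProbabilityMeasure (uniformOn (Set.univ : Set (Library N L))) :=
    isProbabilityMeasure_uniformOn Set.finite_univ Set.univ_nonempty
  refine iSup₂_le fun D k => ?_
  have : IsProbabilityMeasure (sourceNoiseLaw N L K (π.TE D H)) := by
    unfold sourceNoiseLaw; infer_instance
  exact prob_le_one

end ErrorProb

/-! ### The enhanced receiver: side information, synthesized signals, guesses. -/

section Converse

variable {M K N : ℕ} {μ CF P : ℝ} {L : ℕ}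

/-- The noiseless signal at user `k`. -/
noncomputable def Policy.signal (π : Policy M K N μ CF P L) (D : Demand K N) (H : Channel K M)
    (F : Library N L) (k : Fin K) : Fin (π.TE D H) → ℂ :=
  fun t => ∑ m, H k m * π.input D H m F t

/-- The signal that a receiver forms on behalf of user `k`, from the observations `y` of the users
in `A` and the codewords of the edge nodes in `E`. For `k ∈ B` the observations are combined with
the coefficients `c k`; the other users use their own observation. Independent noise of
standard deviation `b k` is added. -/
noncomputable def Policy.synth (π : Policy M K N μ CF P L) (D : Demand K N) (H : Channel K M)
    (A B : Finset (Fin K)) (E : Finset (Fin M)) (c : Fin K → Fin K → ℂ) (b : Fin K → ℝ)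
    (y : Fin (π.TE D H) → Option (Fin K) → ℂ) (F : Library N L) (k : Fin K) :
    Fin (π.TE D H) → ℂ :=
  fun t => (if k ∈ B then
      ∑ j ∈ A, c k j * (y t (some j) - ∑ m ∈ E, H j m * π.input D H m F t)
        + ∑ m ∈ E, H k m * π.input D H m F t
    else y t (some k)) + b k * y t none

/-- The likelihood of the cached contents, at the edge nodes in `E`, of the files requested by
the users in `B`, and of the fronthaul messages to the edge nodes in `E`. -/
noncomputable def Policy.sideWeight (π : Policy M K N μ CF P L) (D : Demand K N) (H : Channel K M)
    (B : Finset (Fin K)) (E : Finset (Fin M)) (F : Library N L) : ℝ :=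
  (∏ p : {p // p ∈ E ×ˢ B}, fiberProb (π.cache p.1.1 (D p.1.2)) (F (D p.1.2))) *
    ∏ m : {m // m ∈ E}, fiberProb (π.message D H m) F

lemma Policy.sideWeight_pos (π : Policy M K N μ CF P L) (D : Demand K N) (H : Channel K M)
    (B : Finset (Fin K)) (E : Finset (Fin M)) (F : Library N L) : 0 < π.sideWeight D H B E F :=
  mul_pos (Finset.prod_pos fun _ _ => fiberProb_pos _ _)
    (Finset.prod_pos fun _ _ => fiberProb_pos _ _)

lemma Policy.isKraft_sideWeight (π : Policy M K N μ CF P L) (D : Demand K N) (H : Channel K M)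
    (B : Finset (Fin K)) (E : Finset (Fin M)) :
    IsKraft (fun F : Library N L =>
      ((fun p : {p // p ∈ E ×ˢ B} => π.cache p.1.1 (D p.1.2) (F (D p.1.2))),
        (fun m : {m // m ∈ E} => π.message D H m F))) (π.sideWeight D H B E) :=
  (IsKraft.pi fun p : {p // p ∈ E ×ˢ B} =>
    (isKraft_fiberProb (π.cache p.1.1 (D p.1.2))).comp fun F : Library N L => F (D p.1.2)).prodMk
    (IsKraft.pi fun m : {m // m ∈ E} => isKraft_fiberProb (π.message D H m))

lemma sum_apply_library {g : File L → ℝ} (n : Fin N) :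
    ∑ F : Library N L, g (F n)
      = Fintype.card (Library N L) * ((∑ x, g x) / Fintype.card (File L)) := by
  classical
  have h1 : ∑ F : Library N L, g (F n) =
      ∑ x, ((Finset.univ.filter fun F : Library N L => F n = x).card : ℝ) * g x := by
    rw [← Finset.sum_fiberwise Finset.univ (fun F : Library N L => F n)]
    refine Finset.sum_congr rfl fun x _ => ?_
    rw [Finset.sum_congr rfl fun F hF => by rw [(Finset.mem_filter.1 hF).2], Finset.sum_const,
      nsmul_eq_mul]
  have h2 : ∀ x, ((Finset.univ.filter fun F : Library N L => F n = x).card : ℝ)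
      = (Fintype.card (Library N L) : ℝ) / Fintype.card (File L) := by
    intro x
    have h3 : (Finset.univ.filter fun F : Library N L => F n = x)
        = Fintype.piFinset (fun i => if i = n then {x} else Finset.univ) := by
      ext F
      simp only [Finset.mem_filter, Finset.mem_univ, true_and, Fintype.mem_piFinset]
      constructor
      · intro hx i
        split_ifs with hi
        · subst hi; simpa using hx
        · simp
      · intro hF; simpa using hF n
    rw [h3, Fintype.card_piFinset, eq_div_iff (by simp)]
    rw [← Finset.mul_prod_erase _ _ (Finset.mem_univ n)]
    have h4 : ∏ i ∈ Finset.univ.erase n, (if i = n then ({x} : Finset (File L)) else Finset.univ).card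
        = ∏ i ∈ Finset.univ.erase n, Fintype.card (File L) := by
      refine Finset.prod_congr rfl fun i hi => ?_
      rw [if_neg (Finset.ne_of_mem_erase hi), Finset.card_univ]
    rw [h4]
    have h5 : Fintype.card (Library N L)
        = Fintype.card (File L) * ∏ i ∈ Finset.univ.erase n, Fintype.card (File L) := by
      rw [Finset.mul_prod_erase _ (fun _ => Fintype.card (File L)) (Finset.mem_univ n)]
      simp [Library]
    rw [h5]
    simp
    ring
  rw [h1, Finset.sum_congr rfl fun x _ => by rw [h2 x], ← Finset.mul_sum]
  ring

/-- The cost of the side information: each pair of an edge node in `E` and a user in `B` contributes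
a cache entropy, at most μL, and each edge node in `E` a message entropy, at most `TF * CF`. -/
lemma Policy.sum_logb_sideWeight_ge (π : Policy M K N μ CF P L) (D : Demand K N)
    (H : Channel K M) (B : Finset (Fin K)) (E : Finset (Fin M)) :
    -(Fintype.card (Library N L) * (E.card * B.card * (μ * L) + E.card * (π.TF D H * CF)))
      ≤ ∑ F, Real.logb 2 (π.sideWeight D H B E F) := by
  have h1 : ∀ F : Library N L, Real.logb 2 (π.sideWeight D H B E F)
      = ∑ p ∈ E ×ˢ B, Real.logb 2 (fiberProb (π.cache p.1 (D p.2)) (F (D p.2)))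
        + ∑ m ∈ E, Real.logb 2 (fiberProb (π.message D H m) F) := fun F => by
    rw [Policy.sideWeight, Real.logb_mul
      (Finset.prod_ne_zero_iff.2 fun _ _ => (fiberProb_pos _ _).ne')
      (Finset.prod_ne_zero_iff.2 fun _ _ => (fiberProb_pos _ _).ne'),
      Real.logb_prod _ _ fun _ _ => (fiberProb_pos _ _).ne',
      Real.logb_prod _ _ fun _ _ => (fiberProb_pos _ _).ne']
    congr 1
    · exact Finset.sum_coe_sort (E ×ˢ B)
        fun p => Real.logb 2 (fiberProb (π.cache p.1 (D p.2)) (F (D p.2)))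
    · exact Finset.sum_coe_sort E fun m => Real.logb 2 (fiberProb (π.message D H m) F)
  simp_rw [h1]
  rw [Finset.sum_add_distrib, Finset.sum_comm, Finset.sum_comm (s := Finset.univ) (t := E)]
  have hc : (0 : ℝ) ≤ Fintype.card (Library N L) := by positivity
  have h2 : ∀ p ∈ E ×ˢ B, -((Fintype.card (Library N L) : ℝ) * (μ * L)) ≤
      ∑ F : Library N L, Real.logb 2 (fiberProb (π.cache p.1 (D p.2)) (F (D p.2))) := by
    intro p _
    rw [sum_apply_library (g := fun x => Real.logb 2 (fiberProb (π.cache p.1 (D p.2)) x)),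
      sum_logb_fiberProb, neg_div, mul_div_cancel_left₀ _ (by simp), mul_neg]
    exact neg_le_neg (mul_le_mul_of_nonneg_left (π.cache_le _ _) hc)
  have h3 : ∀ m ∈ E, -((Fintype.card (Library N L) : ℝ) * (π.TF D H * CF)) ≤
      ∑ F : Library N L, Real.logb 2 (fiberProb (π.message D H m) F) := by
    intro m _
    rw [sum_logb_fiberProb]
    exact neg_le_neg (mul_le_mul_of_nonneg_left (π.fronthaul_le m D H) hc)
  have h4 := Finset.sum_le_sum h2
  have h5 := Finset.sum_le_sum h3
  rw [Finset.sum_const, nsmul_eq_mul, Finset.card_product] at h4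
  rw [Finset.sum_const, nsmul_eq_mul] at h5
  push_cast at h4
  linarith

/-- The guesses formed by the receiver from the observations `y`. -/
noncomputable def Policy.guess (π : Policy M K N μ CF P L) (D : Demand K N) (H : Channel K M)
    (A B : Finset (Fin K)) (E : Finset (Fin M)) (c : Fin K → Fin K → ℂ) (b : Fin K → ℝ)
    (y : Fin (π.TE D H) → Option (Fin K) → ℂ) (F : Library N L) : Library N L :=
  Function.extend D (fun k => π.decode k (D k) H (π.TE D H) (π.synth D H A B E c b y F k))
    fun _ => 0

lemma Policy.guess_apply (π : Policy M K N μ CF P L) {D : Demand K N}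
    (hD : Function.Injective D) (H : Channel K M)
    (A B : Finset (Fin K)) (E : Finset (Fin M)) (c : Fin K → Fin K → ℂ) (b : Fin K → ℝ)
    (y : Fin (π.TE D H) → Option (Fin K) → ℂ) (F : Library N L) (k : Fin K) :
    π.guess D H A B E c b y F (D k)
      = π.decode k (D k) H (π.TE D H) (π.synth D H A B E c b y F k) :=
  hD.extend_apply _ _ _

lemma Policy.measurable_guess (π : Policy M K N μ CF P L) {D : Demand K N}
    (hD : Function.Injective D) (H : Channel K M)
    (A B : Finset (Fin K)) (E : Finset (Fin M)) (c : Fin K → Fin K → ℂ) (b : Fin K → ℝ)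
    (F : Library N L) (n : Fin N) :
    Measurable fun y => π.guess D H A B E c b y F n := by
  by_cases hn : ∃ k, D k = n
  · obtain ⟨k, rfl⟩ := hn
    simp only [π.guess_apply hD]
    refine (π.measurable_decode k (D k) H _).comp ?_
    unfold Policy.synth
    split_ifs <;> fun_prop
  · simp only [Policy.guess, Function.extend_apply' _ _ _ hn]
    exact measurable_const

/-- For fixed observations `y`, users outside `B` are decoded from `y` alone. Users in `B` also need
the codewords of `E`, which are determined by the paid side information and the files not requested
by `B`. This is the setting of `sum_guess_le`. -/
lemma Policy.sum_sideWeight_mul_guess_le (π : Policy M K N μ CF P L) {D : Demand K N}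
    (hD : Function.Injective D) (H : Channel K M)
    (A B : Finset (Fin K)) (E : Finset (Fin M)) (c : Fin K → Fin K → ℂ) (b : Fin K → ℝ)
    (S : Finset (Fin N)) (y : Fin (π.TE D H) → Option (Fin K) → ℂ) :
    ∑ F : Library N L, π.sideWeight D H B E F *
      ∏ n, indexWeight L S n (π.guess D H A B E c b y F n) (F n) ≤ 1 := by
  classical
  refine sum_guess_le (π.isKraft_sideWeight D H B E) (B.map ⟨D, hD⟩) (indexWeight L S)
    (fun n c x => (indexWeight_pos L S n c x).le) (sum_indexWeight_le L S)
    (π.guess D H A B E c b y 0) (π.guess D H A B E c b y) ?_ ?_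
  · intro F n hn
    by_cases h : ∃ k, D k = n
    · obtain ⟨k, rfl⟩ := h
      have hk : k ∉ B := fun hk => hn (Finset.mem_map.2 ⟨k, hk, rfl⟩)
      have hs : π.synth D H A B E c b y F k = π.synth D H A B E c b y 0 k := by
        funext t
        simp only [Policy.synth, hk, if_false]
      rw [π.guess_apply hD, π.guess_apply hD, hs]
    · simp only [Policy.guess, Function.extend_apply' _ _ _ h]
  · intro F F' hτ hF n _
    obtain ⟨h1, h2⟩ := Prod.mk.inj hτ
    have hin : ∀ m ∈ E, π.input D H m F = π.input D H m F' := by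
      intro m hm
      have hc : π.cached m F = π.cached m F' := by
        funext i
        by_cases hi : i ∈ B.map ⟨D, hD⟩
        · obtain ⟨k, hk, rfl⟩ := Finset.mem_map.1 hi
          exact congrFun h1 ⟨(m, k), Finset.mem_product.2 ⟨hm, hk⟩⟩
        · simp only [Policy.cached, hF i hi]
      have hu : π.message D H m F = π.message D H m F' := congrFun h2 ⟨m, hm⟩
      simp only [Policy.input, hc, hu]
    have hs : π.synth D H A B E c b y F = π.synth D H A B E c b y F' := by
      funext k t
      have h3 : ∀ j, ∑ m ∈ E, H j m * π.input D H m F t = ∑ m ∈ E, H j m * π.input D H m F' t :=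
        fun j => Finset.sum_congr rfl fun m hm => by rw [hin m hm]
      simp only [Policy.synth, h3]
    simp only [Policy.guess, hs]

/-- The mean of the observations: the noiseless signals. -/
noncomputable def Policy.blockMean (π : Policy M K N μ CF P L) (D : Demand K N) (H : Channel K M)
    (F : Library N L) : Fin (π.TE D H) → Option (Fin K) → ℂ :=
  fun t i => i.elim 0 fun k => π.signal D H F k t

open Classical in
/-- The coefficients of the noise in the synthesized signal of user `k`. -/
noncomputable def synthNoise (A : Finset (Fin K)) (σ : ℝ) (c : Fin K → Fin K → ℂ) (b : Fin K → ℝ)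
    (k : Fin K) : Option (Fin K) → ℂ :=
  fun i => i.elim (b k : ℂ) fun j => if j ∈ A then c k j * σ else 0

/-- Once the codewords of `E` are subtracted, only the columns outside `E` remain, where by `hcB`
row `k` is a combination of the rows in `A`. The result is the true signal of user `k` with another
noise. -/
lemma Policy.synth_shifted (π : Policy M K N μ CF P L) (D : Demand K N) (H : Channel K M)
    {A B : Finset (Fin K)} {E : Finset (Fin M)} {c : Fin K → Fin K → ℂ}
    (hcA : ∀ k ∈ A, ∀ j ∈ A, c k j = if j = k then 1 else 0)
    (hcB : ∀ k ∈ B, ∀ m ∉ E, H k m = ∑ j ∈ A, c k j * H j m) (b : Fin K → ℝ) (σ : ℝ)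
    (F : Library N L) (ζ : Fin (π.TE D H) → Option (Fin K) → ℂ) {k : Fin K} (hk : k ∈ A ∪ B) :
    π.synth D H A B E c b
        (shifted (A.map Function.Embedding.some) σ (π.blockMean D H F) ζ) F k
      = fun t => ∑ m, H k m * π.input D H m F t + ∑ i, synthNoise A σ c b k i * ζ t i := by
  classical
  funext t
  have hnone : shifted (A.map Function.Embedding.some) σ (π.blockMean D H F) ζ t none
      = ζ t none := by simp [shifted]
  have hsome : ∀ j ∈ A, shifted (A.map Function.Embedding.some) σ (π.blockMean D H F) ζ t (some j)
      = π.signal D H F j t + σ * ζ t (some j) := fun j hj => by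
    simp [shifted, hj, Policy.blockMean]
  have hnoise : ∑ i, synthNoise A σ c b k i * ζ t i
      = ∑ j ∈ A, c k j * (σ * ζ t (some j)) + b k * ζ t none := by
    rw [Fintype.sum_option]
    simp only [synthNoise, Option.elim, ite_mul, zero_mul, Finset.sum_ite_mem, Finset.univ_inter]
    rw [add_comm]
    simp only [mul_assoc]
  rw [Policy.synth, hnone, hnoise, ← add_assoc]
  congr 1
  by_cases hB : k ∈ B
  · rw [if_pos hB]
    have h1 : ∀ j ∈ A, c k j * (shifted (A.map Function.Embedding.some) σ (π.blockMean D H F) ζ t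
        (some j) - ∑ m ∈ E, H j m * π.input D H m F t)
        = ∑ m ∈ Eᶜ, c k j * H j m * π.input D H m F t + c k j * (σ * ζ t (some j)) := by
      intro j hj
      rw [hsome j hj, Policy.signal, ← Finset.sum_add_sum_compl E]
      simp only [mul_assoc]
      rw [← Finset.mul_sum]
      ring
    rw [Finset.sum_congr rfl h1, Finset.sum_add_distrib, Finset.sum_comm]
    have h2 : ∑ m ∈ Eᶜ, ∑ j ∈ A, c k j * H j m * π.input D H m F t
        = ∑ m ∈ Eᶜ, H k m * π.input D H m F t := by
      refine Finset.sum_congr rfl fun m hm => ?_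
      rw [hcB k hB m (Finset.mem_compl.1 hm), Finset.sum_mul]
    rw [h2, ← Finset.sum_add_sum_compl E fun m => H k m * π.input D H m F t]
    ring
  · have hA : k ∈ A := (Finset.mem_union.1 hk).resolve_right hB
    rw [if_neg hB, hsome k hA, Policy.signal]
    congr 1
    rw [Finset.sum_eq_single_of_mem k hA fun j hj hjk => by rw [hcA k hA j hj, if_neg hjk, zero_mul],
      hcA k hA k hA, if_pos rfl, one_mul]

/-- The weight on the extra coordinate `none` tops the variance up to 1. The noises of different
users become correlated, which is harmless as each error event involves one user only. -/
lemma sum_norm_sq_synthNoise (A : Finset (Fin K)) (σ : ℝ) (c : Fin K → Fin K → ℂ) (k : Fin K)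
    (h : σ ^ 2 * ∑ j ∈ A, ‖c k j‖ ^ 2 ≤ 1) :
    ∑ i, ‖synthNoise A σ c (fun k => Real.sqrt (1 - σ ^ 2 * ∑ j ∈ A, ‖c k j‖ ^ 2)) k i‖ ^ 2
      = 1 := by
  classical
  rw [Fintype.sum_option]
  simp only [synthNoise, Option.elim]
  have h1 : ∀ j, ‖(if j ∈ A then c k j * (σ : ℂ) else 0)‖ ^ 2
      = if j ∈ A then σ ^ 2 * ‖c k j‖ ^ 2 else 0 := by
    intro j
    split_ifs
    · rw [norm_mul, Complex.norm_real, Real.norm_eq_abs, mul_pow, sq_abs, mul_comm]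
    · simp
  simp only [h1, Finset.sum_ite_mem, Finset.univ_inter]
  rw [Complex.norm_real, Real.norm_eq_abs, sq_abs, Real.sq_sqrt (by linarith), ← Finset.mul_sum]
  ring

lemma Policy.sum_norm_sq_signal_le (π : Policy M K N μ CF P L) (D : Demand K N) (H : Channel K M)
    (k : Fin K) :
    ∑ F : Library N L, ∑ t, ‖π.signal D H F k t‖ ^ 2
      ≤ Fintype.card (Library N L) * ((∑ m, ‖H k m‖ ^ 2) * (M * (π.TE D H * P))) := by
  have hc : (0 : ℝ) < Fintype.card (Library N L) := by
    exact_mod_cast Fintype.card_pos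
  have h1 : ∀ F t, ‖π.signal D H F k t‖ ^ 2
      ≤ (∑ m, ‖H k m‖ ^ 2) * ∑ m, ‖π.input D H m F t‖ ^ 2 := by
    intro F t
    have h2 : ‖π.signal D H F k t‖ ≤ ∑ m, ‖H k m‖ * ‖π.input D H m F t‖ := by
      refine (norm_sum_le _ _).trans_eq ?_
      simp only [norm_mul]
    exact (pow_le_pow_left₀ (norm_nonneg _) h2 2).trans
      (Finset.sum_mul_sq_le_sq_mul_sq Finset.univ _ _)
  have h3 : ∀ m, ∑ F : Library N L, ∑ t, ‖π.input D H m F t‖ ^ 2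
      ≤ Fintype.card (Library N L) * (π.TE D H * P) := by
    intro m
    have := π.power_le m D H
    rw [div_le_iff₀ hc] at this
    rw [mul_comm]
    exact this
  calc ∑ F : Library N L, ∑ t, ‖π.signal D H F k t‖ ^ 2
      ≤ ∑ F : Library N L, ∑ t, (∑ m, ‖H k m‖ ^ 2) * ∑ m, ‖π.input D H m F t‖ ^ 2 :=
        Finset.sum_le_sum fun F _ => Finset.sum_le_sum fun t _ => h1 F t
    _ = (∑ m, ‖H k m‖ ^ 2) * ∑ m, ∑ F : Library N L, ∑ t, ‖π.input D H m F t‖ ^ 2 := by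
        simp_rw [← Finset.mul_sum]
        congr 1
        rw [Finset.sum_comm (s := (Finset.univ : Finset (Fin M)))]
        refine Finset.sum_congr rfl fun F _ => Finset.sum_comm
    _ ≤ (∑ m, ‖H k m‖ ^ 2) * ∑ _m : Fin M, Fintype.card (Library N L) * (π.TE D H * P) := by
        gcongr with m
        exact h3 m
    _ = _ := by
        rw [Finset.sum_const, Finset.card_univ, Fintype.card_fin, nsmul_eq_mul]
        ring

end Converse

/-! ### The finite-blocklength converse. -/

section ConverseBound

variable {M K N : ℕ} {μ CF P : ℝ} {L : ℕ}

lemma logb_card_library (N L : ℕ) : Real.logb 2 (Fintype.card (Library N L)) = N * L := by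
  have : (Fintype.card (Library N L) : ℝ) = 2 ^ (N * L) := by
    simp [Library, mul_comm N L, pow_mul]
  rw [this, Real.logb_pow, Real.logb_self_eq_one (by norm_num)]
  push_cast; ring

/-- The files requested by the users in `A ∪ B` are recovered from the (enhanced) observations of
the users in `A`, the cached contents of the files requested by `B` at the edge nodes in `E`, and
the fronthaul messages to those. -/
theorem Policy.converse (π : Policy M K N μ CF P L) {D : Demand K N}
    (hD : Function.Injective D) (H : Channel K M)
    {A B : Finset (Fin K)} (hAB : Disjoint A B) {E : Finset (Fin M)} {c : Fin K → Fin K → ℂ}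
    (hcA : ∀ k ∈ A, ∀ j ∈ A, c k j = if j = k then 1 else 0)
    (hcB : ∀ k ∈ B, ∀ m ∉ E, H k m = ∑ j ∈ A, c k j * H j m) {σ β : ℝ} (hσ : 0 < σ)
    (hcσ : ∀ k ∈ A ∪ B, σ ^ 2 * ∑ j ∈ A, ‖c k j‖ ^ 2 ≤ 1) (hβ : 0 < β)
    (hPβ : ∀ j ∈ A, 2 * ((∑ m, ‖H j m‖ ^ 2) * (M * P)) + 2 * σ ^ 2 ≤ β) :
    ((A.card : ℝ) + B.card) * L ≤ A.card * (π.TE D H * Real.logb 2 (β / σ ^ 2))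
      + (A.card + B.card) * (1 + L * (π.errorProb H).toReal)
      + E.card * B.card * (μ * L) + E.card * (π.TF D H * CF) := by
  classical
  set T := π.TE D H
  set Γ := gaussianBlock (Fin T) (Option (Fin K))
  set n₀ : ℝ := (Fintype.card (Library N L) : ℝ) with hn₀
  have hn₀pos : 0 < n₀ := Nat.cast_pos.2 Fintype.card_pos
  let S : Finset (Option (Fin K)) := A.map Function.Embedding.some
  let I : Finset (Fin N) := (A ∪ B).map ⟨D, hD⟩
  have hI : (I.card : ℝ) = A.card + B.card := by
    rw [Finset.card_map, Finset.card_union_of_disjoint hAB]; push_cast; rfl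
  let b : Fin K → ℝ := fun k => Real.sqrt (1 - σ ^ 2 * ∑ j ∈ A, ‖c k j‖ ^ 2)
  let a : Library N L → Fin T → Option (Fin K) → ℂ := π.blockMean D H
  let v : (Fin T → Option (Fin K) → ℂ) → Library N L → Library N L := π.guess D H A B E c b
  -- The likelihood of `F` given `y`, relative to the uniform law on libraries; hence the factor
  -- `n₀`.
  let q : (Fin T → Option (Fin K) → ℂ) → Library N L → ℝ := fun y F =>
    n₀ * (π.sideWeight D H B E F * ∏ n, indexWeight L I n (v y F n) (F n))
  have hq0 : ∀ y F, 0 < q y F := fun y F => mul_pos hn₀pos (mul_pos (π.sideWeight_pos D H B E F)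
    (Finset.prod_pos fun n _ => indexWeight_pos L I n _ _))
  have hqm : ∀ F, Measurable fun y => q y F := fun F => by
    refine Measurable.const_mul (Measurable.const_mul (Finset.measurable_prod _ fun n _ => ?_) _) _
    exact (measurable_of_finite fun x => indexWeight L I n x (F n)).comp
      (π.measurable_guess hD H A B E c b F n)
  have hqsum : ∀ y, ∑ F, q y F ≤ n₀ := fun y => by
    simp only [q]
    rw [← Finset.mul_sum]
    exact mul_le_of_le_one_right hn₀pos.le
      (π.sum_sideWeight_mul_guess_le hD H A B E c b I y)
  let Err : Fin K → Library N L → Set (Fin T → Option (Fin K) → ℂ) := fun k F =>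
    {ζ | π.decode k (D k) H T
      (fun t => ∑ m, H k m * π.input D H m F t + ∑ i, synthNoise A σ c b k i * ζ t i) ≠ F (D k)}
  have hErrm : ∀ k F, MeasurableSet (Err k F) := fun k F => by
    have h : Measurable fun ζ : Fin T → Option (Fin K) → ℂ => π.decode k (D k) H T
        (fun t => ∑ m, H k m * π.input D H m F t + ∑ i, synthNoise A σ c b k i * ζ t i) :=
      (π.measurable_decode k (D k) H T).comp (by fun_prop)
    exact (h (measurableSet_singleton (F (D k)))).compl
  have hguess : ∀ F ζ, ∀ k ∈ A ∪ B, (if v (shifted S σ (a F) ζ) F (D k) = F (D k) then (0 : ℝ) else 1)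
      = (Err k F).indicator 1 ζ := by
    intro F ζ k hk
    have h1 : v (shifted S σ (a F) ζ) F (D k) = π.decode k (D k) H T
        (fun t => ∑ m, H k m * π.input D H m F t + ∑ i, synthNoise A σ c b k i * ζ t i) := by
      rw [← π.synth_shifted D H hcA hcB b σ F ζ hk]
      exact π.guess_apply hD H A B E c b _ F k
    rw [h1, Set.indicator_apply]
    by_cases h : π.decode k (D k) H T
      (fun t => ∑ m, H k m * π.input D H m F t + ∑ i, synthNoise A σ c b k i * ζ t i) = F (D k)
    · have : ζ ∉ Err k F := fun h' => h' h
      rw [if_pos h, if_neg this]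
    · have : ζ ∈ Err k F := h
      rw [if_neg h, if_pos this]; rfl
  let f : Library N L → (Fin T → Option (Fin K) → ℂ) → ℝ := fun F ζ =>
    blockRatio S σ β (a F) ζ * q (shifted S σ (a F) ζ) F
  let κ : Library N L → ℝ := fun F =>
    N * L + (Real.logb 2 (π.sideWeight D H B E F) - ((N : ℝ) - I.card) * L)
  let e : Library N L → (Fin T → Option (Fin K) → ℂ) → ℝ := fun F ζ =>
    ∑ k ∈ A ∪ B, (1 + (L : ℝ) * (Err k F).indicator 1 ζ)
  let g : Library N L → (Fin T → Option (Fin K) → ℂ) → ℝ := fun F ζ =>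
    logRatioBound S σ β (a F) ζ + (κ F - e F ζ)
  have hgf : ∀ F ζ, g F ζ ≤ Real.logb 2 (f F ζ) := by
    intro F ζ
    have h1 : Real.logb 2 (q (shifted S σ (a F) ζ) F) = κ F - e F ζ := by
      simp only [q, κ, e]
      rw [Real.logb_mul hn₀pos.ne' (mul_pos (π.sideWeight_pos D H B E F)
          (Finset.prod_pos fun n _ => indexWeight_pos L I n _ _)).ne',
        Real.logb_mul (π.sideWeight_pos D H B E F).ne'
          (Finset.prod_pos fun n _ => indexWeight_pos L I n _ _).ne',
        logb_card_library, logb_prod_indexWeight, Finset.sum_map]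
      have h3 : ∑ k ∈ A ∪ B, (1 + (L : ℝ) *
          if v (shifted S σ (a F) ζ) F (D k) = F (D k) then (0 : ℝ) else 1)
            = ∑ k ∈ A ∪ B, (1 + (L : ℝ) * (Err k F).indicator 1 ζ) :=
        Finset.sum_congr rfl fun k hk => by rw [hguess F ζ k hk]
      rw [← h3]
      simp only [Function.Embedding.coeFn_mk]
      ring
    simp only [f, g]
    rw [Real.logb_mul (blockRatio_pos hσ hβ _ _ _).ne' (hq0 _ _).ne', h1]
    linarith [logRatioBound_le hσ hβ S (a F) ζ]
  have hind : ∀ k F, Integrable ((Err k F).indicator (1 : (Fin T → Option (Fin K) → ℂ) → ℝ)) Γ := fun k F =>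
    (integrable_const (1 : ℝ)).indicator (hErrm k F)
  have heint : ∀ F, Integrable (e F) Γ := fun F =>
    integrable_finsetSum _ fun k _ => (integrable_const _).add ((hind k F).const_mul _)
  have hgint : ∀ F, Integrable (g F) Γ := fun F =>
    (integrable_logRatioBound S σ β (a F)).add ((integrable_const _).sub (heint F))
  -- After the change of measure the observations do not depend on `F`, so the bound `hqsum` applies
  -- pointwise under one integral.
  have hfsum : ∑ F, ∫⁻ ζ, ENNReal.ofReal (f F ζ) ∂Γ ≤ Fintype.card (Library N L) := by
    have h1 : ∀ F, ∫⁻ ζ, ENNReal.ofReal (f F ζ) ∂Γ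
        = ∫⁻ ζ, ENNReal.ofReal (q (rescaled S β ζ) F) ∂Γ := fun F => by
      rw [← lintegral_blockRatio_mul hσ hβ S (a F) (hqm F).ennreal_ofReal]
      refine lintegral_congr fun ζ => ?_
      simp only [f]
      rw [ENNReal.ofReal_mul (blockRatio_pos hσ hβ _ _ _).le]
    simp_rw [h1]
    have hm : ∀ F : Library N L, Measurable fun ζ => ENNReal.ofReal (q (rescaled S β ζ) F) :=
      fun F => ((hqm F).comp (measurable_rescaled S β)).ennreal_ofReal
    rw [← lintegral_finsetSum _ fun F _ => hm F]
    calc ∫⁻ ζ, ∑ F, ENNReal.ofReal (q (rescaled S β ζ) F) ∂Γ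
        ≤ ∫⁻ _, ENNReal.ofReal n₀ ∂Γ := by
          refine lintegral_mono fun ζ => ?_
          rw [← ENNReal.ofReal_sum_of_nonneg fun F _ => (hq0 _ F).le]
          exact ENNReal.ofReal_le_ofReal (hqsum _)
      _ = Fintype.card (Library N L) := by simp [hn₀]
  have hmain := sum_integral_le_zero_of_le_logb (Γ := Γ)
    (fun F ζ => mul_pos (blockRatio_pos hσ hβ S (a F) ζ) (hq0 (shifted S σ (a F) ζ) F))
    (fun F => (measurable_blockRatio S σ β (a F)).mul
      ((hqm F).comp (measurable_shifted S σ (a F)))) hfsum hgint hgf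
  have hgI : ∀ F, ∫ ζ, g F ζ ∂Γ = ∑ t, ∑ i ∈ S, (Real.logb 2 (σ ^ 2 / β) +
          (1 - (2 * ‖a F t i‖ ^ 2 + 2 * σ ^ 2) / β) / Real.log 2)
        + (κ F - ∑ k ∈ A ∪ B, (1 + (L : ℝ) * Γ.real (Err k F))) := by
    intro F
    have hd : Integrable (fun ζ => κ F - e F ζ) Γ := (integrable_const _).sub (heint F)
    simp only [g]
    rw [integral_add (integrable_logRatioBound S σ β (a F)) hd,
      integral_logRatioBound, integral_sub (integrable_const _) (heint F), integral_const]
    have hk : ∀ k, Integrable (fun ζ => 1 + (L : ℝ) * (Err k F).indicator 1 ζ) Γ := fun k =>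
      (integrable_const _).add ((hind k F).const_mul _)
    simp only [e]
    rw [integral_finsetSum _ fun k _ => hk k]
    congr 1
    congr 1
    · simp
    · refine Finset.sum_congr rfl fun k _ => ?_
      rw [integral_add (integrable_const _) ((hind k F).const_mul _), integral_const_mul,
        integral_indicator_one (hErrm k F)]
      simp
  simp_rw [hgI] at hmain
  have h2 : 0 < Real.log 2 := Real.log_pos (by norm_num)
  -- By the power constraint and `hPβ`, the mean of 2|a|² + 2σ² over libraries and time is at most
  -- β, so the quadratic correction is nonnegative on average and can be dropped.
  have hratio : n₀ * (A.card * (T * Real.logb 2 (σ ^ 2 / β)))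
      ≤ ∑ F : Library N L, ∑ t, ∑ i ∈ S, (Real.logb 2 (σ ^ 2 / β) +
          (1 - (2 * ‖a F t i‖ ^ 2 + 2 * σ ^ 2) / β) / Real.log 2) := by
    have h3 : ∀ F : Library N L, ∑ t, ∑ i ∈ S, (Real.logb 2 (σ ^ 2 / β) +
          (1 - (2 * ‖a F t i‖ ^ 2 + 2 * σ ^ 2) / β) / Real.log 2)
        = ∑ j ∈ A, (T * Real.logb 2 (σ ^ 2 / β) +
          (T * (1 - 2 * σ ^ 2 / β) - 2 / β * ∑ t, ‖π.signal D H F j t‖ ^ 2) / Real.log 2) := by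
      intro F
      rw [Finset.sum_comm, Finset.sum_map]
      refine Finset.sum_congr rfl fun j _ => ?_
      have h4 : ∀ t, a F t (Function.Embedding.some j) = π.signal D H F j t := fun t => rfl
      simp_rw [h4]
      rw [Finset.sum_add_distrib, Finset.sum_const, Finset.card_univ, Fintype.card_fin,
        nsmul_eq_mul, ← Finset.sum_div]
      congr 2
      rw [Finset.mul_sum, Finset.sum_sub_distrib]
      simp only [add_div, Finset.sum_add_distrib, Finset.sum_const, Finset.card_univ,
        Fintype.card_fin, nsmul_eq_mul]
      rw [Finset.sum_congr rfl fun t _ => mul_div_right_comm 2 (‖π.signal D H F j t‖ ^ 2) β]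
      ring
    simp_rw [h3]
    rw [Finset.sum_comm]
    have h5 : ∀ j ∈ A, n₀ * (T * Real.logb 2 (σ ^ 2 / β)) ≤ ∑ F : Library N L,
        (T * Real.logb 2 (σ ^ 2 / β) +
          (T * (1 - 2 * σ ^ 2 / β) - 2 / β * ∑ t, ‖π.signal D H F j t‖ ^ 2) / Real.log 2) := by
      intro j hj
      rw [Finset.sum_add_distrib, Finset.sum_const, Finset.card_univ, nsmul_eq_mul,
        ← Finset.sum_div, Finset.sum_sub_distrib, ← Finset.mul_sum, Finset.sum_const,
        Finset.card_univ, nsmul_eq_mul, ← hn₀]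
      refine le_add_of_nonneg_right (div_nonneg ?_ h2.le)
      have h6 := π.sum_norm_sq_signal_le D H j
      rw [← hn₀] at h6
      have h7 : 2 / β * ∑ F : Library N L, ∑ t, ‖π.signal D H F j t‖ ^ 2
          ≤ 2 / β * (n₀ * ((∑ m, ‖H j m‖ ^ 2) * (M * (T * P)))) := by gcongr
      have h8 : 0 ≤ n₀ * T / β * (β - (2 * ((∑ m, ‖H j m‖ ^ 2) * (M * P)) + 2 * σ ^ 2)) :=
        mul_nonneg (by positivity) (sub_nonneg.2 (hPβ j hj))
      have h9 : n₀ * T / β * (β - (2 * ((∑ m, ‖H j m‖ ^ 2) * (M * P)) + 2 * σ ^ 2))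
          = n₀ * (T * (1 - 2 * σ ^ 2 / β)) -
            2 / β * (n₀ * ((∑ m, ‖H j m‖ ^ 2) * (M * (T * P)))) := by
        field_simp
        ring
      rw [Finset.mul_sum] at h7
      linarith
    refine le_trans (le_of_eq ?_) (Finset.sum_le_sum h5)
    rw [Finset.sum_const, nsmul_eq_mul]
    ring
  have herr : ∀ k ∈ A ∪ B, ∑ F, Γ.real (Err k F) ≤ n₀ * (π.errorProb H).toReal := by
    intro k hk
    have h3 := sum_measure_error_le π D H k (synthNoise A σ c b k)
      (sum_norm_sq_synthNoise A σ c k (hcσ k hk))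
    have hfin : (Fintype.card (Library N L) : ℝ≥0∞) * π.errorProb H ≠ ∞ :=
      ENNReal.mul_ne_top (ENNReal.natCast_ne_top _)
        (ne_top_of_le_ne_top ENNReal.one_ne_top (errorProb_le_one π H))
    have h4 := ENNReal.toReal_mono hfin h3
    rw [ENNReal.toReal_sum fun F _ => measure_ne_top _ _, ENNReal.toReal_mul,
      ENNReal.toReal_natCast] at h4
    exact h4
  have hside := π.sum_logb_sideWeight_ge D H B E
  rw [← hn₀] at hside
  rw [Finset.sum_add_distrib, Finset.sum_sub_distrib] at hmain
  have hκ : ∑ F, κ F = n₀ * (N * L) + (∑ F, Real.logb 2 (π.sideWeight D H B E F)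
      - n₀ * (((N : ℝ) - I.card) * L)) := by
    simp only [κ]
    rw [Finset.sum_add_distrib, Finset.sum_sub_distrib, Finset.sum_const, Finset.sum_const,
      Finset.card_univ, nsmul_eq_mul, nsmul_eq_mul]
  have hE : ∑ F : Library N L, ∑ k ∈ A ∪ B, (1 + (L : ℝ) * Γ.real (Err k F))
      ≤ n₀ * ((A.card + B.card) * (1 + L * (π.errorProb H).toReal)) := by
    rw [Finset.sum_comm]
    have h3 : ∀ k ∈ A ∪ B, ∑ F : Library N L, (1 + (L : ℝ) * Γ.real (Err k F))
        ≤ n₀ * (1 + L * (π.errorProb H).toReal) := by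
      intro k hk
      rw [Finset.sum_add_distrib, ← Finset.mul_sum, Finset.sum_const, Finset.card_univ,
        nsmul_eq_mul, ← hn₀]
      have := mul_le_mul_of_nonneg_left (herr k hk) (Nat.cast_nonneg (α := ℝ) L)
      linarith
    refine (Finset.sum_le_sum h3).trans (le_of_eq ?_)
    rw [Finset.sum_const, nsmul_eq_mul, Finset.card_union_of_disjoint hAB]
    push_cast
    ring
  have hlog : Real.logb 2 (β / σ ^ 2) = -Real.logb 2 (σ ^ 2 / β) := by
    rw [← Real.logb_inv, inv_div]
  rw [hκ, hI] at hmain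
  refine le_of_mul_le_mul_left ?_ hn₀pos
  rw [hlog]
  linarith

end ConverseBound

/-! ### Generic channels: nonvanishing leading minors. -/

section GenericChannel

/-- A set is null for a product measure if all its sections along some coordinate are null. -/
lemma pi_null_of_update {ι : Type*} [Fintype ι] [DecidableEq ι] {X : ι → Type*}
    [∀ i, MeasurableSpace (X i)] (μ : ∀ i, Measure (X i)) [∀ i, IsProbabilityMeasure (μ i)]
    {S : Set (∀ i, X i)} (hS : MeasurableSet S) (i : ι)
    (h : ∀ x, μ i {a | Function.update x i a ∈ S} = 0) : Measure.pi μ S = 0 := by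
  rw [← lintegral_indicator_one hS]
  have hm : Measurable (S.indicator (1 : (∀ i, X i) → ℝ≥0∞)) := measurable_one.indicator hS
  have h0 := lintegral_le_of_lmarginal_le (μ := μ) {i} (g := fun _ => 0) hm measurable_const ?_
  · simpa using h0
  · intro x
    rw [lmarginal_singleton]
    have h1 : (fun a => S.indicator (1 : (∀ i, X i) → ℝ≥0∞) (Function.update x i a))
        = (Function.update x i ⁻¹' S).indicator 1 := by
      funext a
      by_cases ha : Function.update x i a ∈ S <;> simp [ha]
    beta_reduce
    rw [h1, lintegral_indicator_one (measurable_update x hS)]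
    exact (h x).le.trans zero_le

variable {M K : ℕ}

/-- The leading square submatrix of the channel matrix. -/
def leadingMatrix {l : ℕ} (hK : l ≤ K) (hM : l ≤ M) (H : Channel K M) :
    Matrix (Fin l) (Fin l) ℂ :=
  Matrix.of fun i j => H (Fin.castLE hK i) (Fin.castLE hM j)

lemma measurable_det_leadingMatrix {l : ℕ} (hK : l ≤ K) (hM : l ≤ M) :
    Measurable fun H : Channel K M => (leadingMatrix hK hM H).det := by
  simp only [Matrix.det_apply, leadingMatrix, Matrix.of_apply]
  fun_prop

/-- Laplace expansion along the last row: the minor is affine in its corner entry, with the previous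
leading minor as slope. If that slope is nonzero, a single value of the entry kills the minor. -/
lemma det_leadingMatrix_update {l : ℕ} (hK : l + 1 ≤ K) (hM : l + 1 ≤ M) (H : Channel K M) :
    ∃ w : ℂ, ∀ x : ℂ, (leadingMatrix hK hM (Function.update H (Fin.castLE hK (Fin.last l))
        (Function.update (H (Fin.castLE hK (Fin.last l))) (Fin.castLE hM (Fin.last l)) x))).det
      = x * (leadingMatrix (Nat.le_of_succ_le hK) (Nat.le_of_succ_le hM) H).det + w := by
  set k := Fin.castLE hK (Fin.last l)
  set m := Fin.castLE hM (Fin.last l)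
  refine ⟨∑ j : Fin l, (-1) ^ ((Fin.last l : ℕ) + (Fin.castSucc j : ℕ)) *
    H k (Fin.castLE hM (Fin.castSucc j)) *
      ((leadingMatrix hK hM H).submatrix (Fin.last l).succAbove (Fin.castSucc j).succAbove).det,
    fun x => ?_⟩
  have hrow : ∀ i : Fin l, Fin.castLE hK i.castSucc ≠ k := fun i h => by
    have := congrArg Fin.val h
    simp [k] at this
    exact absurd this i.2.ne
  have hcol : ∀ i : Fin l, Fin.castLE hM i.castSucc ≠ m := fun i h => by
    have := congrArg Fin.val h
    simp [m] at this
    exact absurd this i.2.ne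
  set H' := Function.update H k (Function.update (H k) m x) with hH'
  have hsub : ∀ j : Fin (l + 1),
      (leadingMatrix hK hM H').submatrix (Fin.last l).succAbove j.succAbove
        = (leadingMatrix hK hM H).submatrix (Fin.last l).succAbove j.succAbove := by
    intro j
    ext i i'
    simp only [Matrix.submatrix_apply, leadingMatrix, Matrix.of_apply, Fin.succAbove_last, hH']
    rw [Function.update_of_ne (hrow i)]
  have hlast : (leadingMatrix hK hM H).submatrix (Fin.last l).succAbove (Fin.last l).succAbove
      = leadingMatrix (Nat.le_of_succ_le hK) (Nat.le_of_succ_le hM) H := by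
    ext i i'
    simp [leadingMatrix]
  rw [Matrix.det_succ_row _ (Fin.last l), Fin.sum_univ_castSucc, add_comm]
  congr 1
  · rw [hsub, hlast, Even.neg_one_pow ⟨_, rfl⟩, one_mul]
    congr 1
    simp [leadingMatrix, hH', k, m]
  · refine Finset.sum_congr rfl fun j _ => ?_
    rw [hsub]
    congr 2
    simp only [leadingMatrix, Matrix.of_apply, hH']
    rw [show Fin.castLE hK (Fin.last l) = k from rfl, Function.update_self,
      Function.update_of_ne (hcol j)]

/-- For an atomless channel law, the leading minors almost surely do not vanish. -/
lemma ae_det_leadingMatrix_ne_zero (ν : Measure ℂ) [IsProbabilityMeasure ν]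
    (hν : ∀ z : ℂ, ν {z} = 0) :
    ∀ (l : ℕ) (hK : l ≤ K) (hM : l ≤ M),
      ∀ᵐ H ∂(channelLaw K M ν), (leadingMatrix hK hM H).det ≠ 0 := by
  intro l
  induction l with
  | zero => intro hK hM; exact ae_of_all _ fun H => by simp
  | succ l ih =>
    intro hK hM
    set k := Fin.castLE hK (Fin.last l) with hk
    set m := Fin.castLE hM (Fin.last l) with hm
    let S : Set (Channel K M) := {H | (leadingMatrix hK hM H).det = 0 ∧
      (leadingMatrix (Nat.le_of_succ_le hK) (Nat.le_of_succ_le hM) H).det ≠ 0}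
    have hSm : MeasurableSet S :=
      (measurable_det_leadingMatrix hK hM (measurableSet_singleton 0)).inter
        (measurable_det_leadingMatrix (Nat.le_of_succ_le hK) (Nat.le_of_succ_le hM)
          (measurableSet_singleton 0)).compl
    have hdet : ∀ (H : Channel K M) (r : Fin M → ℂ),
        leadingMatrix (Nat.le_of_succ_le hK) (Nat.le_of_succ_le hM) (Function.update H k r)
          = leadingMatrix (Nat.le_of_succ_le hK) (Nat.le_of_succ_le hM) H := by
      intro H r
      ext i j
      simp only [leadingMatrix, Matrix.of_apply]
      rw [Function.update_of_ne]
      intro h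
      have := congrArg Fin.val h
      simp [hk] at this
      exact absurd this i.2.ne
    have hS : channelLaw K M ν S = 0 := by
      refine pi_null_of_update _ hSm k fun H => ?_
      -- The channel law is a product of products, so the corner entry is isolated in two stages,
      -- row `k` and then column `m`; the remaining section is at most one point, null because `ν`
      -- is atomless.
      refine pi_null_of_update _ (measurable_update H hSm) m fun r => ?_
      obtain ⟨w, hw⟩ := det_leadingMatrix_update hK hM (Function.update H k r)
      simp only [← hk, ← hm, Function.update_self, Function.update_idem, hdet] at hw
      refine measure_mono_null (t := {-w /
        (leadingMatrix (Nat.le_of_succ_le hK) (Nat.le_of_succ_le hM) H).det}) ?_ (hν _)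
      rintro x ⟨h1, h2⟩
      rw [hw] at h1
      rw [hdet] at h2
      rw [Set.mem_singleton_iff, eq_div_iff h2]
      exact eq_neg_of_add_eq_zero_left h1
    have hS' : ∀ᵐ H ∂(channelLaw K M ν), H ∉ S := measure_eq_zero_iff_ae_notMem.1 hS
    filter_upwards [ih (Nat.le_of_succ_le hK) (Nat.le_of_succ_le hM), hS'] with H h1 h2 h3
    exact h2 ⟨h3, h1⟩

/-- If a leading minor does not vanish, all rows of the channel matrix are, on the leading columns,
combinations of the leading rows. -/
lemma exists_coeff_of_det_ne_zero {l : ℕ} (hK : l ≤ K) (hM : l ≤ M) {H : Channel K M}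
    (h : (leadingMatrix hK hM H).det ≠ 0) :
    ∃ c : Fin K → Fin K → ℂ,
      (∀ k ∈ Finset.univ.map (Fin.castLEEmb hK), ∀ j ∈ Finset.univ.map (Fin.castLEEmb hK),
        c k j = if j = k then 1 else 0) ∧
      ∀ k ∉ Finset.univ.map (Fin.castLEEmb hK), ∀ m ∈ Finset.univ.map (Fin.castLEEmb hM),
        H k m = ∑ j ∈ Finset.univ.map (Fin.castLEEmb hK), c k j * H j m := by
  classical
  have hinj : Function.Injective (Fin.castLE hK) := Fin.castLE_injective hK
  let x : Fin K → Fin l → ℂ := fun k =>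
    Matrix.vecMul (fun j => H k (Fin.castLE hM j)) (leadingMatrix hK hM H)⁻¹
  have hx : ∀ k, Matrix.vecMul (x k) (leadingMatrix hK hM H) = fun j => H k (Fin.castLE hM j) := by
    intro k
    simp only [x]
    rw [Matrix.vecMul_vecMul, Matrix.nonsing_inv_mul _ (isUnit_iff_ne_zero.2 h), Matrix.vecMul_one]
  refine ⟨fun k => if k ∈ Finset.univ.map (Fin.castLEEmb hK) then fun j => if j = k then 1 else 0
    else Function.extend (Fin.castLE hK) (x k) 0, ?_, ?_⟩
  · intro k hk j _
    simp only [hk, if_true]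
  · intro k hk m hm
    obtain ⟨j, -, rfl⟩ := Finset.mem_map.1 hm
    simp only [hk, if_false]
    rw [Finset.sum_map]
    simp only [Fin.castLEEmb_apply, hinj.extend_apply]
    exact (congrFun (hx k) j).symm

end GenericChannel

/-! ### From policies to the linear program: large files, then large power. -/

section Limit

variable {M K N : ℕ} {μ : ℝ}

/-- The converse bound with a power-independent additive loss in the rate per channel use. -/
lemma exists_converse_bound (H : Channel K M)
    {A B : Finset (Fin K)} (hAB : Disjoint A B) {E : Finset (Fin M)} {c : Fin K → Fin K → ℂ}
    (hcA : ∀ k ∈ A, ∀ j ∈ A, c k j = if j = k then 1 else 0)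
    (hcB : ∀ k ∈ B, ∀ m ∉ E, H k m = ∑ j ∈ A, c k j * H j m) :
    ∃ κ : ℝ, ∀ (CF P : ℝ), 1 ≤ P → ∀ (L : ℕ) (π : Policy M K N μ CF P L) (D : Demand K N),
      Function.Injective D →
      ((A.card : ℝ) + B.card) * L ≤ A.card * (π.TE D H * (Real.logb 2 P + κ))
        + (A.card + B.card) * (1 + L * (π.errorProb H).toReal)
        + E.card * B.card * (μ * L) + E.card * (π.TF D H * CF) := by
  -- σ² = 1/Q is small enough for every synthesized noise to have variance at most 1 before topping
  -- up, and depends on the channel only. Below, β = C P with `C` independent of P ≥ 1, so the rate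
  -- loss κ is independent of P.
  let Q : ℝ := 1 + ∑ k, ∑ j, ‖c k j‖ ^ 2
  have hQ : 0 < Q := by positivity
  let σ : ℝ := Real.sqrt Q⁻¹
  have hσ : 0 < σ := Real.sqrt_pos.2 (by positivity)
  have hσ2 : σ ^ 2 = Q⁻¹ := Real.sq_sqrt (by positivity)
  have hcσ : ∀ k ∈ A ∪ B, σ ^ 2 * ∑ j ∈ A, ‖c k j‖ ^ 2 ≤ 1 := by
    intro k _
    rw [hσ2, inv_mul_le_iff₀ hQ, mul_one]
    calc ∑ j ∈ A, ‖c k j‖ ^ 2 ≤ ∑ j, ‖c k j‖ ^ 2 :=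
          Finset.sum_le_univ_sum_of_nonneg fun j => by positivity
      _ ≤ ∑ k, ∑ j, ‖c k j‖ ^ 2 :=
          Finset.single_le_sum (f := fun k => ∑ j, ‖c k j‖ ^ 2) (fun k _ => by positivity)
            (Finset.mem_univ k)
      _ ≤ Q := by simp [Q]
  let C : ℝ := 2 * ((∑ j, ∑ m, ‖H j m‖ ^ 2) * M) + 2 * σ ^ 2
  have hC : 0 < C := by positivity
  refine ⟨Real.logb 2 (C / σ ^ 2), fun CF P hP L π D hD => ?_⟩
  have hP0 : 0 < P := by linarith
  have h := π.converse hD H hAB hcA hcB hσ hcσ (β := C * P) (by positivity) ?_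
  · rwa [show C * P / σ ^ 2 = P * (C / σ ^ 2) by ring,
      Real.logb_mul hP0.ne' (by positivity)] at h
  · intro j _
    have h1 : ∑ m, ‖H j m‖ ^ 2 ≤ ∑ j, ∑ m, ‖H j m‖ ^ 2 :=
      Finset.single_le_sum (f := fun j => ∑ m, ‖H j m‖ ^ 2) (fun k _ => by positivity)
        (Finset.mem_univ j)
    have h2 : (∑ m, ‖H j m‖ ^ 2) * (M * P) ≤ (∑ j, ∑ m, ‖H j m‖ ^ 2) * (M * P) := by gcongr
    have h3 : 2 * σ ^ 2 * 1 ≤ 2 * σ ^ 2 * P := by gcongr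
    simp only [C]
    linarith

/-- One user decoding its own file from its own output, without side information; this yields δ_E ≥
1. -/
lemma exists_single_user_bound (hK : 1 ≤ K) (H : Channel K M) :
    ∃ κ : ℝ, ∀ (CF P : ℝ), 1 ≤ P → ∀ (L : ℕ) (π : Policy M K N μ CF P L) (D : Demand K N),
      Function.Injective D →
      (L : ℝ) ≤ π.TE D H * (Real.logb 2 P + κ) + (1 + L * (π.errorProb H).toReal) := by
  obtain ⟨κ, hκ⟩ := exists_converse_bound (N := N) (μ := μ) H (A := {⟨0, hK⟩}) (B := ∅) (E := ∅)
    (c := fun k j => if j = k then 1 else 0) (by simp) (fun _ _ _ _ => rfl) (by simp)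
  refine ⟨κ, fun CF P hP L π D hD => ?_⟩
  simpa using hκ CF P hP L π D hD

lemma exists_leading_bound {l : ℕ} (hK : l ≤ K) (hM : l ≤ M) {H : Channel K M}
    (h : (leadingMatrix hK hM H).det ≠ 0) :
    ∃ κ : ℝ, ∀ (CF P : ℝ), 1 ≤ P → ∀ (L : ℕ) (π : Policy M K N μ CF P L) (D : Demand K N),
      Function.Injective D →
      (K : ℝ) * L ≤ l * (π.TE D H * (Real.logb 2 P + κ)) + K * (1 + L * (π.errorProb H).toReal)
        + ((M : ℝ) - l) * ((K : ℝ) - l) * (μ * L) + ((M : ℝ) - l) * (π.TF D H * CF) := by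
  obtain ⟨c, hcA, hcB⟩ := exists_coeff_of_det_ne_zero hK hM h
  obtain ⟨κ, hκ⟩ := exists_converse_bound (N := N) (μ := μ) H
    (A := Finset.univ.map (Fin.castLEEmb hK)) (B := (Finset.univ.map (Fin.castLEEmb hK))ᶜ)
    (E := (Finset.univ.map (Fin.castLEEmb hM))ᶜ) disjoint_compl_right hcA
    (fun k hk m hm => hcB k (Finset.mem_compl.1 hk) m (by simpa using hm))
  refine ⟨κ, fun CF P hP L π D hD => ?_⟩
  have h1 := hκ CF P hP L π D hD
  simp only [Finset.card_compl, Finset.card_map, Finset.card_univ, Fintype.card_fin,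
    Nat.cast_sub hK, Nat.cast_sub hM] at h1
  rwa [add_sub_cancel] at h1

/-- Limit points of asymptotically feasible points are feasible for the linear program. -/
lemma exists_LPFeasible_of_approx {r d : ℝ} {κ : ℕ → ℝ} {κ' : ℝ} {x y s η X : ℕ → ℝ}
    (hx : ∀ i, 0 ≤ x i) (hy : ∀ i, 0 ≤ y i) (hxy : ∀ i, x i + y i ≤ X i)
    (hX : Tendsto X atTop (𝓝 d)) (hs : Tendsto s atTop atTop) (hη : Tendsto η atTop (𝓝 0))
    (h : ∀ l : ℕ, l ≤ min M K → ∀ i, (K : ℝ) - ((M : ℝ) - l) * ((K : ℝ) - l) * μ - K * η i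
      ≤ l * (y i * (1 + κ l / s i)) + ((M : ℝ) - l) * r * x i)
    (h' : ∀ i, 1 - η i ≤ y i * (1 + κ' / s i)) :
    ∃ a b, LPFeasible M K μ r a b ∧ a + b ≤ d := by
  obtain ⟨R, hR⟩ := hX.bddAbove_range
  have hR' : ∀ i, X i ≤ R := fun i => hR ⟨i, rfl⟩
  have hmem : ∀ i, (x i, y i) ∈ Set.Icc (0 : ℝ) R ×ˢ Set.Icc (0 : ℝ) R := fun i =>
    ⟨⟨hx i, by linarith [hxy i, hy i, hR' i]⟩, ⟨hy i, by linarith [hxy i, hx i, hR' i]⟩⟩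
  -- The two normalized durations need not converge separately; only their sum is controlled, and
  -- nonnegativity makes both bounded.
  obtain ⟨⟨a, b⟩, -, φ, hφ, hlim⟩ := (isCompact_Icc.prod isCompact_Icc).tendsto_subseq hmem
  have ha : Tendsto (fun i => x (φ i)) atTop (𝓝 a) := (continuous_fst.tendsto _).comp hlim
  have hb : Tendsto (fun i => y (φ i)) atTop (𝓝 b) := (continuous_snd.tendsto _).comp hlim
  have hφ' := hφ.tendsto_atTop
  have hη' : Tendsto (fun i => η (φ i)) atTop (𝓝 0) := hη.comp hφ'
  have hκ : ∀ t : ℝ, Tendsto (fun i => y (φ i) * (1 + t / s (φ i))) atTop (𝓝 b) := fun t => by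
    have h1 : Tendsto (fun i => t / s (φ i)) atTop (𝓝 0) :=
      tendsto_const_nhds.div_atTop (hs.comp hφ')
    simpa using hb.mul (h1.const_add 1)
  refine ⟨a, b, ⟨fun l hl => ?_, ?_, ?_⟩, ?_⟩
  · refine le_of_tendsto_of_tendsto' ?_ (((hκ (κ l)).const_mul (l : ℝ)).add
      (ha.const_mul (((M : ℝ) - l) * r))) fun i => h l hl (φ i)
    simpa using (hη'.const_mul (K : ℝ)).const_sub ((K : ℝ) - ((M : ℝ) - l) * ((K : ℝ) - l) * μ)
  · exact ge_of_tendsto' ha fun i => hx _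
  · refine le_of_tendsto_of_tendsto' ?_ (hκ κ') fun i => h' (φ i)
    simpa using hη'.const_sub 1
  · exact le_of_tendsto_of_tendsto' (ha.add hb) (hX.comp hφ') fun i => hxy (φ i)

/-- At a fixed power, one file size at which all the losses are below ε; `s` plays the role of log₂
P. A limsup bounds the delivery time for all large L, so it can be met together with the other
conditions. -/
lemma exists_large_file {CF P : ℝ} (π : (L : ℕ) → Policy M K N μ CF P L) (H : Channel K M)
    (D : Demand K N) (hfeas : Tendsto (fun L => (π L).errorProb H) atTop (𝓝 0))
    (hfin : deliveryTimePerBit π H ≠ ∞) {ε : ℝ} (hε : 0 < ε) (s : ℝ) (hs : 0 < s) :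
    ∃ L : ℕ, 0 < L ∧ 1 / (L : ℝ) ≤ ε ∧ ((π L).errorProb H).toReal ≤ ε ∧
      (((π L).TF D H : ℝ) + (π L).TE D H) * s / L
        ≤ (deliveryTimePerBit π H * ENNReal.ofReal s).toReal + ε := by
  have h1 : ∀ᶠ L : ℕ in atTop, (π L).deliveryTime H / (L : ℝ≥0∞)
      < deliveryTimePerBit π H + ENNReal.ofReal (ε / s) := by
    refine eventually_lt_of_limsup_lt ?_
    exact ENNReal.lt_add_right hfin (by simpa using div_pos hε hs)
  have h2 : ∀ᶠ L : ℕ in atTop, (π L).errorProb H < ENNReal.ofReal ε :=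
    hfeas.eventually_lt_const (by simpa using hε)
  have h3 : ∀ᶠ L : ℕ in atTop, 1 / (L : ℝ) < ε :=
    tendsto_one_div_atTop_nhds_zero_nat.eventually_lt_const hε
  obtain ⟨L, hL1, hL2, hL3, hL4⟩ := (h1.and (h2.and (h3.and (eventually_gt_atTop 0)))).exists
  refine ⟨L, hL4, hL3.le, ENNReal.toReal_le_of_le_ofReal hε.le hL2.le, ?_⟩
  have hLpos : (0 : ℝ) < L := by exact_mod_cast hL4
  have h4 : (((π L).TF D H : ℝ≥0∞) + (π L).TE D H) / (L : ℝ≥0∞)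
      ≤ deliveryTimePerBit π H + ENNReal.ofReal (ε / s) := by
    refine le_trans ?_ hL1.le
    gcongr
    exact le_iSup (fun D => ((π L).TF D H : ℝ≥0∞) + (π L).TE D H) D
  have h5 := ENNReal.toReal_mono (ENNReal.add_ne_top.2 ⟨hfin, ENNReal.ofReal_ne_top⟩) h4
  rw [ENNReal.toReal_add hfin ENNReal.ofReal_ne_top, ENNReal.toReal_ofReal (by positivity),
    ENNReal.toReal_div, ENNReal.toReal_add (ENNReal.natCast_ne_top _) (ENNReal.natCast_ne_top _)]
    at h5
  simp only [ENNReal.toReal_natCast] at h5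
  rw [ENNReal.toReal_mul, ENNReal.toReal_ofReal hs.le]
  have h6 := mul_le_mul_of_nonneg_right h5 hs.le
  rw [add_mul, div_mul_cancel₀ _ hs.ne'] at h6
  rwa [mul_div_right_comm]

lemma exists_LPFeasible_of_achievable (hK : 1 ≤ K) (hKN : K ≤ N) (ν : Measure ℂ)
    [IsProbabilityMeasure ν] (hν : ∀ z : ℂ, ν {z} = 0) {r : ℝ} {δ : ℝ≥0∞}
    (hδ : AchievableNDT M K N ν μ r δ) (hδfin : δ ≠ ∞) :
    ∃ a b, LPFeasible M K μ r a b ∧ a + b ≤ δ.toReal := by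
  obtain ⟨π, hfeas, hlim⟩ := hδ
  obtain ⟨P₀, hP₀⟩ := eventually_atTop.1 hfeas
  have : IsProbabilityMeasure (channelLaw K M ν) := by unfold channelLaw; infer_instance
  -- The exceptional null set in feasibility depends on P. Restricting to integer powers leaves
  -- countably many null sets, so one channel serves all of them.
  have hfeas' : ∀ᵐ H ∂(channelLaw K M ν), ∀ j : ℕ, P₀ ≤ j →
      Tendsto (fun L => (π j L).errorProb H) atTop (𝓝 0) := by
    rw [ae_all_iff]
    intro j
    by_cases hj : P₀ ≤ j
    · filter_upwards [hP₀ j hj] with H hH _ using hH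
    · exact ae_of_all _ fun H h => absurd h hj
  have hgen : ∀ᵐ H ∂(channelLaw K M ν), ∀ (l : ℕ) (hK : l ≤ K) (hM : l ≤ M),
      (leadingMatrix hK hM H).det ≠ 0 := by
    rw [ae_all_iff]
    intro l
    by_cases h : l ≤ K ∧ l ≤ M
    · filter_upwards [ae_det_leadingMatrix_ne_zero ν hν l h.1 h.2] with H hH _ _ using hH
    · exact ae_of_all _ fun H h1 h2 => absurd ⟨h1, h2⟩ h
  obtain ⟨H, hH1, hH2, hH3⟩ := (hfeas'.and (hlim.and hgen)).exists
  let D : Demand K N := Fin.castLE hKN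
  have hD : Function.Injective D := Fin.castLE_injective hKN
  have hκ : ∀ l : ℕ, ∃ κ : ℝ, l ≤ min M K → ∀ (CF P : ℝ), 1 ≤ P → ∀ (L : ℕ)
      (π : Policy M K N μ CF P L) (D : Demand K N), Function.Injective D →
      (K : ℝ) * L ≤ l * (π.TE D H * (Real.logb 2 P + κ)) + K * (1 + L * (π.errorProb H).toReal)
        + ((M : ℝ) - l) * ((K : ℝ) - l) * (μ * L) + ((M : ℝ) - l) * (π.TF D H * CF) := by
    intro l
    by_cases hl : l ≤ min M K
    · obtain ⟨κ, hκ⟩ := exists_leading_bound (N := N) (μ := μ) (hl.trans (min_le_right _ _))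
        (hl.trans (min_le_left _ _)) (hH3 l (hl.trans (min_le_right _ _))
        (hl.trans (min_le_left _ _)))
      exact ⟨κ, fun _ => hκ⟩
    · exact ⟨0, fun h => absurd h hl⟩
  choose κ hκ using hκ
  obtain ⟨κ', hκ'⟩ := exists_single_user_bound (N := N) (μ := μ) hK H
  have hlim' := hH2.comp tendsto_natCast_atTop_atTop
  obtain ⟨j₁, hj₁⟩ := eventually_atTop.1 (hlim'.eventually_ne hδfin)
  obtain ⟨p, hp⟩ := exists_nat_ge P₀
  -- Beyond `j₁` the delivery time is finite, beyond `p` the policies are feasible, and from 2 on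
  -- log₂ P is positive.
  let j₀ : ℕ := max (max j₁ p) 2
  let j : ℕ → ℕ := fun i => i + j₀
  have hj2 : ∀ i, 2 ≤ j i := fun i => (le_max_right _ _).trans (Nat.le_add_left _ _)
  have hjj₁ : ∀ i, j₁ ≤ j i := fun i =>
    ((le_max_left _ _).trans (le_max_left _ _)).trans (Nat.le_add_left _ _)
  have hjP : ∀ i, P₀ ≤ j i := fun i => hp.trans (Nat.cast_le.2
    (((le_max_right _ _).trans (le_max_left _ _)).trans (Nat.le_add_left _ _)))
  have hj1 : ∀ i, (1 : ℝ) < j i := fun i => by exact_mod_cast (hj2 i)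
  let s : ℕ → ℝ := fun i => Real.logb 2 (j i)
  have hs0 : ∀ i, 0 < s i := fun i => Real.logb_pos (by norm_num) (hj1 i)
  have hjtop : Tendsto j atTop atTop := tendsto_add_atTop_nat j₀
  have hjtop' : Tendsto (fun i => (j i : ℝ)) atTop atTop :=
    tendsto_natCast_atTop_atTop.comp hjtop
  have hsTop : Tendsto s atTop atTop :=
    (Real.tendsto_logb_atTop (by norm_num)).comp hjtop'
  have hfin : ∀ i, deliveryTimePerBit (π (j i)) H ≠ ∞ := fun i h => by
    refine hj₁ (j i) (hjj₁ i) ?_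
    simp only [Function.comp_apply, h]
    exact ENNReal.top_mul (by simpa using hs0 i)
  -- With tolerance 1/P at power P = `j i`, the losses vanish along the diagonal sequence.
  choose L hL0 hL1 hL2 hL3 using fun i => exists_large_file (π (j i)) H D (hH1 (j i) (hjP i))
    (hfin i) (one_div_pos.2 (zero_lt_one.trans (hj1 i))) (s i) (hs0 i)
  have hLpos : ∀ i, (0 : ℝ) < L i := fun i => by exact_mod_cast hL0 i
  have hjinv : Tendsto (fun i => 1 / (j i : ℝ)) atTop (𝓝 0) :=
    tendsto_const_nhds.div_atTop hjtop'
  have hKpos : (0 : ℝ) ≤ K := Nat.cast_nonneg K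
  have hslack : ∀ i, 1 / (L i : ℝ) + ((π (j i) (L i)).errorProb H).toReal ≤ 2 * (1 / (j i : ℝ)) :=
    fun i => by linarith [hL1 i, hL2 i]
  refine exists_LPFeasible_of_approx (κ := κ) (κ' := κ') (s := s)
    (x := fun i => (π (j i) (L i)).TF D H * s i / L i)
    (y := fun i => (π (j i) (L i)).TE D H * s i / L i) (η := fun i => 2 * (1 / (j i : ℝ)))
    (X := fun i => (deliveryTimePerBit (π (j i)) H * ENNReal.ofReal (s i)).toReal + 1 / (j i : ℝ))
    (fun i => ?_) (fun i => ?_) (fun i => ?_) ?_ hsTop ?_ (fun l hl i => ?_) (fun i => ?_)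
  · have := hs0 i; positivity
  · have := hs0 i; positivity
  · have := hL3 i
    rw [add_mul, add_div] at this
    exact this
  · have h1 := (ENNReal.tendsto_toReal hδfin).comp (hlim'.comp hjtop)
    simpa using h1.add hjinv
  · simpa using hjinv.const_mul 2
  · have h1 := hκ l hl _ _ (hj1 i).le (L i) (π (j i) (L i)) D hD
    have h2 := mul_le_mul_of_nonneg_left (hslack i) hKpos
    have hL := (hLpos i).ne'
    have hs := (hs0 i).ne'
    have h3 := div_le_div_of_nonneg_right h1 (hLpos i).le
    have h4 : (K : ℝ) * L i / L i = K := by field_simp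
    have h5 : ∀ te tf pe : ℝ, (l * (te * (s i + κ l)) + K * (1 + L i * pe)
        + ((M : ℝ) - l) * ((K : ℝ) - l) * (μ * L i) + ((M : ℝ) - l) * (tf * (r * s i))) / L i
        = l * (te * s i / L i * (1 + κ l / s i)) + K * (1 / (L i : ℝ) + pe)
          + ((M : ℝ) - l) * ((K : ℝ) - l) * μ + ((M : ℝ) - l) * r * (tf * s i / L i) := by
      intro te tf pe
      field_simp
    have h6 := h3.trans_eq (h5 _ _ _)
    rw [h4] at h6
    linarith
  · have h1 := hκ' _ _ (hj1 i).le (L i) (π (j i) (L i)) D hD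
    have h2 := hslack i
    have hL := (hLpos i).ne'
    have hs := (hs0 i).ne'
    have h3 := div_le_div_of_nonneg_right h1 (hLpos i).le
    have h5 : ∀ te pe : ℝ, (te * (s i + κ') + (1 + L i * pe)) / L i
        = te * s i / L i * (1 + κ' / s i) + (1 / (L i : ℝ) + pe) := by
      intro te pe
      field_simp
    have h6 := h3.trans_eq (h5 _ _)
    rw [div_self hL] at h6
    linarith

end Limit

end FRAN

theorem proposition1 (M K N : ℕ) (hK : 1 ≤ K) (hKN : K ≤ N)
    (ν : MeasureTheory.Measure ℂ) [MeasureTheory.IsProbabilityMeasure ν]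
    (hν : ∀ z : ℂ, ν {z} = 0)
    (μ r : ℝ) (hμ0 : 0 ≤ μ) (hμ1 : μ ≤ 1) (hr : 0 ≤ r) :
    FRAN.lpValue M K μ r ≤ FRAN.minNDT M K N ν μ r := by
  refine le_sInf fun δ hδ => ?_
  by_cases hfin : δ = ∞
  · exact hfin ▸ le_top
  · obtain ⟨a, b, hab, hle⟩ := FRAN.exists_LPFeasible_of_achievable hK hKN ν hν hδ hfin
    refine le_trans (sInf_le ⟨a, b, hab, rfl⟩) ?_
    exact (ENNReal.ofReal_le_ofReal hle).trans (ENNReal.ofReal_toReal hfin).le
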